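/- Conventions. For integers $n,k$ with $1\le k<n/2$, the generalized Petersen graph $\mathrm{GP}(n,k)$ has the $2n$ vertices $u_i,v_i$ ($i\in\mathbb Z/n$) and the edges $\{u_i,u_{i+1}\}$, $\{u_i,v_i\}$, $\{v_i,v_{i+k}\}$. The canonical double cover $D(\Gamma)$ of a graph $\Gamma$ has vertex set $V(\Gamma)\times\mathbb Z_2$, with $(u,x)$ and $(v,y)$ adjacent if and only if $u,v$ are adjacent in $\Gamma$ and $x\neq y$. The graph $\Gamma$ is stable if $\mathrm{Aut}(D(\Gamma))=\mathrm{Aut}(\Gamma)\times\mathbb Z_2$, that is, if the natural homomorphism $\mathrm{Aut}(\Gamma)\times\mathbb Z_2\to\mathrm{Aut}(D(\Gamma))$, in which $(g,t)$ acts by $(v,x)\mapsto(g(v),x+t)$, is bijective. Put $\mathrm{DGP}(n,k)=D(\mathrm{GP}(n,k))$ and $A(n,k)=\mathrm{Aut}(\mathrm{DGP}(n,k))$, and let $$F(m)=\langle \rho,\delta\mid\rho^m=\delta^2=1,\ \delta\rho\delta=\rho^{-1}\rangle,$$ $$H(m,l)=\langle \rho,\alpha\mid\rho^m=\alpha^4=1,\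 \alpha\rho\alpha^{-1}=\rho^l\rangle,$$ $$J(m,l)=\langle \rho,\delta,\alpha\mid\rho^m=\delta^2=\alpha^2=1,\ \delta\rho\delta=\rho^{-1},\ \alpha\rho\alpha=\rho^l,\ \alpha\delta\alpha=\delta\rangle.$$ Proposition. Let $n$ and $k$ be integers with $n$ odd and $1\le k<n/2$. If $k$ is odd, then $\mathrm{DGP}(n,k)\cong\mathrm{GP}(2n,k)$; if $k$ is even, then $\mathrm{DGP}(n,k)\cong\mathrm{GP}(2n,n-k)$. In both cases $\mathrm{GP}(n,k)$ is stable. Put $l=k$ if $k$ is odd and $l=n-k$ if $k$ is even. If $(n,k)\neq(5,2)$, then: (1) if $k^2\not\equiv\pm1\pmod n$, then $A(n,k)=F(2n)$; (2) if $k^2\equiv1\pmod n$, then $A(n,k)=J(2n,l)$; (3) if $k^2\equiv-1\pmod n$, then $A(n,k)=H(2n,l)$. Moreover, $A(5,2)\cong S_5\times\mathbb Z_2$. In (1)–(3), equality means that there are a graph isomorphism $e:\mathrm{DGP}(n,k)\to\mathrm{GP}(2n,l)$ and a group isomorphism from the presented group onto $A(n,k)$ (with composition of maps, written on the left, as multiplication)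 under which each generator becomes, after transport along $e$, the following permutation of the vertices of $\mathrm{GP}(2n,l)$: $\rho:\ u_i\mapsto u_{i+1},\ v_i\mapsto v_{i+1}$; $\ \delta:\ u_i\mapsto u_{-i},\ v_i\mapsto v_{-i}$; $\ \alpha:\ u_i\mapsto v_{li},\ v_i\mapsto u_{li}$. In particular, $A(n,k)$ is isomorphic to the presented group. -/

import Mathlib

namespace GenPetersen

/-- The automorphism group of a graph, with composition of maps as multiplication. -/
abbrev AutGroup {V : Type*} (G : SimpleGraph V) : Type _ := G ≃g G

/-- One orientation of each edge of the generalized Petersen graph: `u_i → u_{i+1}`, `u_i → v_i`,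
`v_i → v_{i+k}`, where `Sum.inl i` is `u_i` and `Sum.inr i` is `v_i`, with subscripts modulo `n`. -/
def petersenRel (n k : ℕ) : ZMod n ⊕ ZMod n → ZMod n ⊕ ZMod n → Prop
  | Sum.inl i, Sum.inl j => j = i + 1
  | Sum.inl i, Sum.inr j => j = i
  | Sum.inr i, Sum.inr j => j = i + (k : ZMod n)
  | Sum.inr _, Sum.inl _ => False

/-- The generalized Petersen graph `GP(n,k)`, used for `1 ≤ k < n/2`. -/
def GP (n k : ℕ) : SimpleGraph (ZMod n ⊕ ZMod n) :=
  SimpleGraph.fromRel (petersenRel n k)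

/-- The canonical double cover of a graph, i.e. its direct product with `K₂`: the vertex set is
`V × ℤ₂`, and `(u, x)`, `(v, y)` are adjacent iff `u`, `v` are adjacent and `x ≠ y`. -/
def doubleCover {V : Type*} (G : SimpleGraph V) : SimpleGraph (V × ZMod 2) where
  Adj p q := G.Adj p.1 q.1 ∧ p.2 ≠ q.2
  symm := ⟨fun _ _ h => ⟨h.1.symm, h.2.symm⟩⟩
  loopless := ⟨fun _ h => h.2 rfl⟩

/-- `DGP(n,k)`, the canonical double cover of `GP(n,k)`. -/
abbrev DGP (n k : ℕ) : SimpleGraph ((ZMod n ⊕ ZMod n) × ZMod 2) := doubleCover (GP n k)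

/-- `A(n,k)`, the full automorphism group of `DGP(n,k)`. -/
abbrev A (n k : ℕ) : Type := AutGroup (DGP n k)

/-- The natural action of `Aut(G) × ℤ₂` on the canonical double cover of `G`:
`(g, t)` sends `(v, x)` to `(g v, x + t)`. -/
def coverHom {V : Type*} (G : SimpleGraph V) :
    AutGroup G × Multiplicative (ZMod 2) →* AutGroup (doubleCover G) where
  toFun p :=
    { toEquiv := Equiv.prodCongr p.1.toEquiv (Equiv.addRight p.2.toAdd)
      map_rel_iff' := by
        intro a b
        simp only [doubleCover, Equiv.prodCongr_apply, Prod.map_fst, Prod.map_snd,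
          Equiv.coe_addRight, ne_eq, add_left_inj]
        exact and_congr_left fun _ => p.1.map_rel_iff }
  map_one' := by
    ext a <;> simp
  map_mul' p q := by
    ext a
    · simp
    · simp [add_left_comm, add_comm]

/-- A graph `G` is stable if `Aut(D(G)) = Aut(G) × ℤ₂`, i.e. if the natural homomorphism from
`Aut(G) × ℤ₂` to the automorphism group of the canonical double cover is bijective. -/
def IsStable {V : Type*} (G : SimpleGraph V) : Prop :=
  Function.Bijective (coverHom G)

/-- Generators of `F(n)`. -/
inductive GenF
  | rho
  | delta

/-- Generators of `H(n,k)`. -/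
inductive GenH
  | rho
  | alpha

/-- Generators of `J(n,k)`. -/
inductive GenJ
  | rho
  | delta
  | alpha

/-- Relators of `F(n) = ⟨ρ, δ ∣ ρⁿ = δ² = 1, δρδ = ρ⁻¹⟩`. -/
def relsF (n : ℕ) : Set (FreeGroup GenF) :=
  let ρ := FreeGroup.of GenF.rho
  let δ := FreeGroup.of GenF.delta
  {ρ ^ n, δ ^ 2, δ * ρ * δ * (ρ⁻¹)⁻¹}

/-- Relators of `H(n,k) = ⟨ρ, α ∣ ρⁿ = α⁴ = 1, αρα⁻¹ = ρᵏ⟩`. -/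
def relsH (n k : ℕ) : Set (FreeGroup GenH) :=
  let ρ := FreeGroup.of GenH.rho
  let α := FreeGroup.of GenH.alpha
  {ρ ^ n, α ^ 4, α * ρ * α⁻¹ * (ρ ^ k)⁻¹}

/-- Relators of `J(n,k) = ⟨ρ, δ, α ∣ ρⁿ = δ² = α² = 1, δρδ = ρ⁻¹, αρα = ρᵏ, αδα = δ⟩`. -/
def relsJ (n k : ℕ) : Set (FreeGroup GenJ) :=
  let ρ := FreeGroup.of GenJ.rho
  let δ := FreeGroup.of GenJ.delta
  let α := FreeGroup.of GenJ.alpha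
  {ρ ^ n, δ ^ 2, α ^ 2, δ * ρ * δ * (ρ⁻¹)⁻¹, α * ρ * α * (ρ ^ k)⁻¹, α * δ * α * δ⁻¹}

/-- The rotation `u_i ↦ u_{i+1}`, `v_i ↦ v_{i+1}` of the vertices of `GP(m,l)`. -/
def rotation (m : ℕ) : ZMod m ⊕ ZMod m → ZMod m ⊕ ZMod m :=
  Sum.map (fun i => i + 1) (fun i => i + 1)

/-- The reflection `u_i ↦ u_{-i}`, `v_i ↦ v_{-i}` of the vertices of `GP(m,l)`. -/
def reflection (m : ℕ) : ZMod m ⊕ ZMod m → ZMod m ⊕ ZMod m :=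
  Sum.map (fun i => -i) (fun i => -i)

/-- The exchange `u_i ↦ v_{li}`, `v_i ↦ u_{li}` of the two rims of `GP(m,l)`. -/
def rimSwap (m l : ℕ) : ZMod m ⊕ ZMod m → ZMod m ⊕ ZMod m
  | Sum.inl i => Sum.inr ((l : ZMod m) * i)
  | Sum.inr i => Sum.inl ((l : ZMod m) * i)

/-- The maps that the generators of `F(m)` stand for. -/
def actF (m : ℕ) : GenF → ZMod m ⊕ ZMod m → ZMod m ⊕ ZMod m
  | GenF.rho => rotation m
  | GenF.delta => reflection m

/-- The maps that the generators of `H(m,l)` stand for. -/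
def actH (m l : ℕ) : GenH → ZMod m ⊕ ZMod m → ZMod m ⊕ ZMod m
  | GenH.rho => rotation m
  | GenH.alpha => rimSwap m l

/-- The maps that the generators of `J(m,l)` stand for. -/
def actJ (m l : ℕ) : GenJ → ZMod m ⊕ ZMod m → ZMod m ⊕ ZMod m
  | GenJ.rho => rotation m
  | GenJ.delta => reflection m
  | GenJ.alpha => rimSwap m l

/-- The graph `G` is isomorphic to `GP(m,l)`, and its automorphism group is the group with
generators `S` and relators `rels`, each generator `s` being the automorphism of `G` that is
carried to the map `act s` by the isomorphism from `G` to `GP(m,l)`. -/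
def AutIsPresented {V : Type*} (G : SimpleGraph V) (m l : ℕ) {S : Type} (rels : Set (FreeGroup S))
    (act : S → ZMod m ⊕ ZMod m → ZMod m ⊕ ZMod m) : Prop :=
  ∃ (e : G ≃g GP m l) (f : PresentedGroup rels ≃* AutGroup G),
    ∀ (s : S) (x : V), e (f (PresentedGroup.of s) x) = act s (e x)

/-- `A(n,k) = F(m)`, where `DGP(n,k) ≅ GP(m,l)`, as permutation groups. -/
def AEqF (n k m l : ℕ) : Prop := AutIsPresented (DGP n k) m l (relsF m) (actF m)

/-- `A(n,k) = H(m,l)`, where `DGP(n,k) ≅ GP(m,l)`, as permutation groups. -/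
def AEqH (n k m l : ℕ) : Prop := AutIsPresented (DGP n k) m l (relsH m l) (actH m l)

/-- `A(n,k) = J(m,l)`, where `DGP(n,k) ≅ GP(m,l)`, as permutation groups. -/
def AEqJ (n k m l : ℕ) : Prop := AutIsPresented (DGP n k) m l (relsJ m l) (actJ m l)

end GenPetersen

open GenPetersen

open GenPetersen

namespace GenPetersen

/-! ### Neighbourhoods in `GP(m,l)`. -/

section Adjacency

variable {m l : ℕ}

/-! Let `l` be the odd one of `k` and `n - k`. By the Chinese remainder theorem `ℤ/2n = ℤ/2 × ℤ/n`;
the steps `1` and `l` become `(1,1)` and `(1,±k)`, so both change the sheet, and the double cover is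
`GP(2n,l)` once the inner rim is shifted by one sheet (`coverIso`). The exchange of the sheets
becomes the half turn, and `l² = ±1` modulo `2n` is equivalent to `k² ≡ ±1` modulo `n`, everything
being odd.

The heart is `map_swap`: outside `(n,l) = (5,3)`, every automorphism of `GP(2n,l)` maps spokes to
spokes. For each arc, count the closed nonbacktracking walks of a fixed length that start with it.
The count is an automorphism invariant and depends only on whether the arc lies on the outer rim, on
the inner rim or on a spoke. If the three values are not all equal, the spokes are preserved
(`map_swap_of_invariant`). A walk is a word in formal steps, closed exactly when its displacement `a
+ b l` vanishes modulo `2n`, so the counts are explicit sums of indicators. Length 8 separates the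
classes except for `l = 1`, treated by length 4, and `(13,5)`, treated by length 10.

A spoke-preserving automorphism walks along a rim at constant speed, so it is a rotation times a
power of the reflection, possibly times the rim exchange, which requires `l² = ±1`
(`classification`). Normal forms in the presented groups then give the three cases. All these maps
commute with the half turn, and for a connected graph this yields stability (`isStable_of_commute`).

For the Petersen graph, stability comes from distances in the double cover, and its automorphism
group is `S₅` acting on pairs, bounded above by the 120 3-arcs. -/

lemma adj_inl_inl (h2 : (2 : ZMod m) ≠ 0) {i j : ZMod m} :
    (GP m l).Adj (Sum.inl i) (Sum.inl j) ↔ j = i + 1 ∨ j = i - 1 := by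
  have h1 : (1 : ZMod m) ≠ 0 := fun h => h2 (by linear_combination 2 * h)
  simp only [GP, SimpleGraph.fromRel_adj, petersenRel, ne_eq, Sum.inl.injEq]
  constructor
  · rintro ⟨-, h | h⟩
    · exact Or.inl h
    · right; rw [h]; ring
  · rintro (h | h)
    · exact ⟨fun e => h1 (by linear_combination -h - e), Or.inl h⟩
    · exact ⟨fun e => h1 (by linear_combination e + h), Or.inr (by rw [h]; ring)⟩

lemma adj_inr_inr (h2 : (2 * l : ZMod m) ≠ 0) {i j : ZMod m} :
    (GP m l).Adj (Sum.inr i) (Sum.inr j) ↔ j = i + l ∨ j = i - l := by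
  have h1 : (l : ZMod m) ≠ 0 := fun h => h2 (by rw [h]; ring)
  simp only [GP, SimpleGraph.fromRel_adj, petersenRel, ne_eq, Sum.inr.injEq]
  constructor
  · rintro ⟨-, h | h⟩
    · exact Or.inl h
    · right; rw [h]; ring
  · rintro (h | h)
    · exact ⟨fun e => h1 (by linear_combination -h - e), Or.inl h⟩
    · exact ⟨fun e => h1 (by linear_combination e + h), Or.inr (by rw [h]; ring)⟩

lemma adj_inl_inr {i j : ZMod m} : (GP m l).Adj (Sum.inl i) (Sum.inr j) ↔ j = i := by
  simp [GP, SimpleGraph.fromRel_adj, petersenRel]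

lemma adj_inr_inl {i j : ZMod m} : (GP m l).Adj (Sum.inr i) (Sum.inl j) ↔ j = i := by
  rw [SimpleGraph.adj_comm, adj_inl_inr, eq_comm]

lemma adj_swap (x : ZMod m ⊕ ZMod m) : (GP m l).Adj x x.swap := by
  cases x
  · exact adj_inl_inr.2 rfl
  · exact adj_inr_inl.2 rfl

end Adjacency

/-! ### Walk counts as automorphism invariants. -/

section NonbacktrackingWalks

variable {V : Type*} [Fintype V] [DecidableEq V]

/-- The number of nonbacktracking walks with `j` turns that start with the arc `x → y` and end with
the arc `s → t`. -/
def turnCount (G : SimpleGraph V) [DecidableRel G.Adj] (s t : V) : ℕ → V → V → ℕ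
  | 0, x, y => if x = s ∧ y = t then 1 else 0
  | j + 1, x, y => ∑ z, if G.Adj y z ∧ z ≠ x then turnCount G s t j y z else 0

lemma turnCount_map (G : SimpleGraph V) [DecidableRel G.Adj] (φ : G ≃g G) (s t : V) (j : ℕ)
    (x y : V) : turnCount G (φ s) (φ t) j (φ x) (φ y) = turnCount G s t j x y := by
  induction j generalizing x y with
  | zero => simp [turnCount]
  | succ j ih =>
    simp only [turnCount]
    rw [← Equiv.sum_comp φ.toEquiv]
    refine Finset.sum_congr rfl fun z _ => ?_
    have h : G.Adj (φ y) (φ z) ↔ G.Adj y z := φ.map_rel_iff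
    simp [ih, h]

end NonbacktrackingWalks

/-! ### Walks in `GP(m,l)` as formal words. -/

section Words

/-- A formal position: the rim (`true` for the outer one) and the displacements along the outer and
the inner rim. -/
abbrev Pos := Bool × ℤ × ℤ

/-- The reverse of a step, where `none` is a spoke. -/
def revStep (c : Option Bool) : Option Bool := c.map not

/-- The position reached by a step. -/
def moveStep : Pos → Option Bool → Pos
  | (s, a, b), none => (!s, a, b)
  | (true, a, b), some c => (true, a + (if c then 1 else -1), b)
  | (false, a, b), some c => (false, a, b + (if c then 1 else -1))

/-- The last arcs of all nonbacktracking walks with `j` turns that start with a given arc. -/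
def lastArcs : ℕ → Pos → Option Bool → List (Pos × Option Bool)
  | 0, p, c => [(p, c)]
  | j + 1, p, c => ([none, some true, some false].filter (· ≠ revStep c)).flatMap
      fun d => lastArcs j (moveStep p c) d

/-- The vertex at a given position relative to the base point `i`. -/
def vertexAt (m l : ℕ) (i : ZMod m) : Pos → ZMod m ⊕ ZMod m
  | (true, a, b) => Sum.inl (i + (a + b * l))
  | (false, a, b) => Sum.inr (i + (a + b * l))

/-- The displacements of the closed walks with `j` turns among the formal walks starting with a given
arc. -/
def returns (j : ℕ) (s : Bool) (c : Option Bool) : List (ℤ × ℤ) :=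
  ((lastArcs j (s, 0, 0) c).filter (fun q => q.1.1 = s ∧ q.2 = c)).map fun q => q.1.2

variable {m l : ℕ}

lemma vertexAt_inj_side {i : ZMod m} {p q : Pos} (h : vertexAt m l i p = vertexAt m l i q) :
    p.1 = q.1 := by
  obtain ⟨s, a, b⟩ := p
  obtain ⟨t, a', b'⟩ := q
  cases s <;> cases t <;> simp [vertexAt] at h ⊢

/-- Since `2` and `2l` are nonzero, the forward and backward neighbours on a rim differ. Formal
steps thus correspond bijectively to neighbours, and nonbacktracking walks to reduced words. -/
lemma moveStep_injective (h2 : (2 : ZMod m) ≠ 0) (hl : (2 * l : ZMod m) ≠ 0) (i : ZMod m) (p : Pos)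
    {c d : Option Bool} (h : vertexAt m l i (moveStep p c) = vertexAt m l i (moveStep p d)) :
    c = d := by
  obtain ⟨s, a, b⟩ := p
  rcases c with _ | _ | _ <;> rcases d with _ | _ | _ <;> cases s <;>
    simp [vertexAt, moveStep] at h ⊢
  · exact hl (by linear_combination -h)
  · exact h2 (by linear_combination -h)
  · exact hl (by linear_combination h)
  · exact h2 (by linear_combination h)

lemma vertexAt_moveStep_rev (i : ZMod m) (p : Pos) (c : Option Bool) :
    vertexAt m l i (moveStep (moveStep p c) (revStep c)) = vertexAt m l i p := by
  obtain ⟨s, a, b⟩ := p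
  rcases c with _ | _ | _ <;> cases s <;> simp [vertexAt, moveStep, revStep]

lemma adj_vertexAt_iff (h2 : (2 : ZMod m) ≠ 0) (hl : (2 * l : ZMod m) ≠ 0) (i : ZMod m) (p : Pos)
    (z : ZMod m ⊕ ZMod m) :
    (GP m l).Adj (vertexAt m l i p) z ↔ ∃ c, z = vertexAt m l i (moveStep p c) := by
  obtain ⟨s, a, b⟩ := p
  cases s <;> rcases z with z | z <;>
    simp [vertexAt, moveStep, adj_inl_inl h2, adj_inr_inr hl, adj_inl_inr, adj_inr_inl,
      Option.exists]
  · rw [or_comm]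
    refine or_congr ?_ ?_ <;> ring_nf
  · rw [or_comm]
    refine or_congr ?_ ?_ <;> ring_nf

variable [NeZero m] [DecidableRel (GP m l).Adj]

lemma turnCount_succ_vertexAt (h2 : (2 : ZMod m) ≠ 0) (hl : (2 * l : ZMod m) ≠ 0) (i : ZMod m)
    (s t : ZMod m ⊕ ZMod m) (j : ℕ) (p : Pos) (c : Option Bool) :
    turnCount (GP m l) s t (j + 1) (vertexAt m l i p) (vertexAt m l i (moveStep p c)) =
      ∑ d : Option Bool, if d ≠ revStep c then
        turnCount (GP m l) s t j (vertexAt m l i (moveStep p c))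
          (vertexAt m l i (moveStep (moveStep p c) d)) else 0 := by
  simp only [turnCount]
  rw [← Finset.sum_filter, ← Finset.sum_filter]
  symm
  refine Finset.sum_bij (fun d _ => vertexAt m l i (moveStep (moveStep p c) d)) ?_ ?_ ?_ ?_
  · intro d hd
    simp only [Finset.mem_filter, Finset.mem_univ, true_and] at hd ⊢
    refine ⟨(adj_vertexAt_iff h2 hl _ _ _).2 ⟨d, rfl⟩, fun h => hd ?_⟩
    rw [← vertexAt_moveStep_rev i p c] at h
    exact moveStep_injective h2 hl i _ h
  · intro d _ d' _ h
    exact moveStep_injective h2 hl i _ h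
  · intro z hz
    simp only [Finset.mem_filter, Finset.mem_univ, true_and] at hz
    obtain ⟨d, rfl⟩ := (adj_vertexAt_iff h2 hl _ _ _).1 hz.1
    refine ⟨d, ?_, rfl⟩
    simp only [Finset.mem_filter, Finset.mem_univ, true_and]
    rintro rfl
    exact hz.2 (vertexAt_moveStep_rev i p c)
  · intro d _
    rfl

lemma turnCount_vertexAt (h2 : (2 : ZMod m) ≠ 0) (hl : (2 * l : ZMod m) ≠ 0) (i : ZMod m)
    (s t : ZMod m ⊕ ZMod m) (j : ℕ) (p : Pos) (c : Option Bool) :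
    turnCount (GP m l) s t j (vertexAt m l i p) (vertexAt m l i (moveStep p c)) =
      (lastArcs j p c).countP fun q =>
        vertexAt m l i q.1 = s ∧ vertexAt m l i (moveStep q.1 q.2) = t := by
  induction j generalizing p c with
  | zero => simp [turnCount, lastArcs, List.countP_singleton]
  | succ j ih =>
    rw [turnCount_succ_vertexAt h2 hl]
    simp only [ih, lastArcs, Fintype.sum_option, Fintype.sum_bool]
    rcases c with _ | _ | _ <;> simp [revStep, List.filter]

/-- The number of words in the list `L` of displacements that are trivial modulo `m`. -/
def trivialCount (m l : ℕ) (L : List (ℤ × ℤ)) : ℕ :=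
  L.countP fun q => ((q.1 : ZMod m) + q.2 * l = 0)

/-- Returning to the same arc means returning to the same rim with the same last step and with
displacement zero modulo `m`. The right side is free of the base point `i`, so all arcs of one kind
share one count. -/
lemma turnCount_eq_trivialCount (h2 : (2 : ZMod m) ≠ 0) (hl : (2 * l : ZMod m) ≠ 0) (i : ZMod m)
    (s : Bool) (j : ℕ) (c : Option Bool) :
    turnCount (GP m l) (vertexAt m l i (s, 0, 0)) (vertexAt m l i (moveStep (s, 0, 0) c)) j
        (vertexAt m l i (s, 0, 0)) (vertexAt m l i (moveStep (s, 0, 0) c)) =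
      trivialCount m l (returns j s c) := by
  rw [turnCount_vertexAt h2 hl, trivialCount, returns, List.countP_map, List.countP_filter]
  refine List.countP_congr fun q _ => ?_
  obtain ⟨⟨t, a, b⟩, d⟩ := q
  simp only [decide_eq_true_eq, Function.comp, Bool.and_eq_true]
  constructor
  · rintro ⟨h, h'⟩
    obtain rfl : t = s := vertexAt_inj_side h
    have h0 : (a : ZMod m) + b * l = 0 := by
      cases t <;> simpa [vertexAt] using h
    refine ⟨h0, rfl, ?_⟩
    refine moveStep_injective h2 hl i (t, 0, 0) ?_
    rw [← h']
    rcases d with _ | _ | _ <;> cases t <;> simp [vertexAt, moveStep] <;>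
      first | linear_combination -h0 | linear_combination h0
  · rintro ⟨h0, rfl, rfl⟩
    constructor
    · cases t <;> simpa [vertexAt] using h0
    · rcases d with _ | _ | _ <;> cases t <;> simp [vertexAt, moveStep] <;> linear_combination h0

end Words

/-! ### Closed walks of length 8 by displacement. -/

section Counting

variable {m l : ℕ}

/-- The representative of a displacement up to sign. -/
def normDisp (q : ℤ × ℤ) : ℤ × ℤ :=
  if q.1 < 0 ∨ (q.1 = 0 ∧ q.2 < 0) then (-q.1, -q.2) else q

/-- The indicator of a displacement being trivial modulo `m`. -/
def triv (m l : ℕ) (a b : ℤ) : ℕ := if (a : ZMod m) + b * l = 0 then 1 else 0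

lemma trivialCount_map_normDisp (L : List (ℤ × ℤ)) :
    trivialCount m l (L.map normDisp) = trivialCount m l L := by
  rw [trivialCount, trivialCount, List.countP_map]
  refine List.countP_congr fun q _ => ?_
  obtain ⟨a, b⟩ := q
  simp only [Function.comp, normDisp]
  split_ifs
  · simp only [decide_eq_true_eq, Int.cast_neg]
    constructor <;> intro h <;> linear_combination -h
  · rfl

lemma trivialCount_congr {L L' : List (ℤ × ℤ)} (h : (L.map normDisp).Perm (L'.map normDisp)) :
    trivialCount m l L = trivialCount m l L' := by
  rw [← trivialCount_map_normDisp L, ← trivialCount_map_normDisp L']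
  exact h.countP_eq _

lemma trivialCount_eq_sum (L : List (ℤ × ℤ)) :
    trivialCount m l L = (L.map fun q => triv m l q.1 q.2).sum := by
  induction L with
  | nil => rfl
  | cons q L ih =>
    rw [List.map_cons, List.sum_cons, ← ih, trivialCount, List.countP_cons, add_comm]
    simp [triv, trivialCount]

/-- A closed word of length 8 has 0, 2 or 4 spokes. Without spokes it runs straight, with
displacement `(8,0)` here. With two spokes there are `a` outer and `b` inner steps with `a + b = 6`,
and the coefficient `a` counts the cyclic shifts that start with an outer step. With four spokes all
rim segments have length one, which gives the entries from `0` and `±2`. -/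
lemma trivialCount_outer : trivialCount m l (returns 8 true (some true)) =
    triv m l 8 0 + 2 * triv m l 0 0 + 2 * triv m l 0 2 + 2 * triv m l 2 0 +
      triv m l 2 2 + triv m l 2 (-2) +
      (triv m l 1 5 + triv m l 1 (-5)) + 2 * (triv m l 2 4 + triv m l 2 (-4)) +
      3 * (triv m l 3 3 + triv m l 3 (-3)) + 4 * (triv m l 4 2 + triv m l 4 (-2)) +
      5 * (triv m l 5 1 + triv m l 5 (-1)) := by
  rw [← trivialCount_map_normDisp, trivialCount_eq_sum]
  have : (returns 8 true (some true)).map normDisp =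
    [(2, 2), (2, 0), (5, 1), (0, 2), (0, 0), (4, 2), (3, 3), (2, 4), (1, 5), (2, 0), (2, -2),
      (5, -1), (0, 0), (0, 2), (4, -2), (3, -3), (2, -4), (1, -5), (5, 1), (4, 2), (3, 3), (2, 4),
      (5, -1), (4, -2), (3, -3), (2, -4), (5, 1), (4, 2), (3, 3), (5, -1), (4, -2), (3, -3), (5, 1),
      (4, 2), (5, -1), (4, -2), (5, 1), (5, -1), (8, 0)] := by decide +kernel
  rw [this]
  simp only [List.map_cons, List.map_nil, List.sum_cons, List.sum_nil]
  ring

lemma trivialCount_inner : trivialCount m l (returns 8 false (some true)) =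
    triv m l 0 8 + 2 * triv m l 0 0 + 2 * triv m l 0 2 + 2 * triv m l 2 0 +
      triv m l 2 2 + triv m l 2 (-2) +
      5 * (triv m l 1 5 + triv m l 1 (-5)) + 4 * (triv m l 2 4 + triv m l 2 (-4)) +
      3 * (triv m l 3 3 + triv m l 3 (-3)) + 2 * (triv m l 4 2 + triv m l 4 (-2)) +
      (triv m l 5 1 + triv m l 5 (-1)) := by
  rw [← trivialCount_map_normDisp, trivialCount_eq_sum]
  have : (returns 8 false (some true)).map normDisp =
    [(2, 2), (0, 2), (1, 5), (2, 0), (0, 0), (2, 4), (3, 3), (4, 2), (5, 1), (0, 2), (2, -2),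
      (1, -5), (0, 0), (2, 0), (2, -4), (3, -3), (4, -2), (5, -1), (1, 5), (2, 4), (3, 3), (4, 2),
      (1, -5), (2, -4), (3, -3), (4, -2), (1, 5), (2, 4), (3, 3), (1, -5), (2, -4), (3, -3), (1, 5),
      (2, 4), (1, -5), (2, -4), (1, 5), (1, -5), (0, 8)] := by decide +kernel
  rw [this]
  simp only [List.map_cons, List.map_nil, List.sum_cons, List.sum_nil]
  ring

lemma trivialCount_spoke : trivialCount m l (returns 8 true none) =
    4 * triv m l 0 0 + 4 * triv m l 0 2 + 4 * triv m l 2 0 +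
      2 * triv m l 2 2 + 2 * triv m l 2 (-2) +
      2 * (triv m l 1 5 + triv m l 1 (-5)) + 2 * (triv m l 2 4 + triv m l 2 (-4)) +
      2 * (triv m l 3 3 + triv m l 3 (-3)) + 2 * (triv m l 4 2 + triv m l 4 (-2)) +
      2 * (triv m l 5 1 + triv m l 5 (-1)) := by
  rw [← trivialCount_map_normDisp, trivialCount_eq_sum]
  have : (returns 8 true none).map normDisp =
    [(2, 2), (0, 2), (2, 0), (0, 0), (5, 1), (0, 2), (2, -2), (0, 0), (2, 0), (5, -1), (4, 2),
      (4, -2), (3, 3), (3, -3), (2, 4), (2, -4), (1, 5), (1, -5), (2, 0), (0, 0), (2, -2), (0, 2),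
      (5, -1), (0, 0), (2, 0), (0, 2), (2, 2), (5, 1), (4, -2), (4, 2), (3, -3), (3, 3), (2, -4),
      (2, 4), (1, -5), (1, 5)] := by decide +kernel
  rw [this]
  simp only [List.map_cons, List.map_nil, List.sum_cons, List.sum_nil]
  ring

lemma triv_eq_zero_or (m l : ℕ) (a b : ℤ) :
    triv m l a b = 0 ∨ triv m l a b = 1 ∧ ∃ q : ℤ, a + b * l = m * q := by
  rw [triv]
  split_ifs with h
  · refine Or.inr ⟨rfl, ?_⟩
    have : ((a + b * l : ℤ) : ZMod m) = 0 := by push_cast; exact h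
    exact (ZMod.intCast_zmod_eq_zero_iff_dvd _ _).1 this
  · exact Or.inl rfl

lemma triv_zero_zero : triv m l 0 0 = 1 := by simp [triv]

/-- The multiplier `q` of a relation `a + b l = 2nq` is small. -/
lemma exists_multiplier {n l : ℕ} (hl : l < n) {a b : ℤ} (ha : |a| ≤ 8) (hb : |b| ≤ 8)
    (hn : 3 ≤ n) (h : ∃ q : ℤ, a + b * l = (2 * n : ℕ) * q) :
    ∃ q : ℤ, -5 ≤ q ∧ q ≤ 5 ∧ a + b * l = 2 * (n * q) := by
  obtain ⟨q, hq⟩ := h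
  have hq : a + b * l = 2 * (n * q) := by rw [hq]; push_cast; ring
  have hn' : (3 : ℤ) ≤ n := by exact_mod_cast hn
  have hl' : (l : ℤ) < n := by exact_mod_cast hl
  have hl0 : (0 : ℤ) ≤ l := by positivity
  rw [abs_le] at ha hb
  have h1 : b * l ≤ 8 * n := by nlinarith
  have h2 : -(8 * n) ≤ b * l := by nlinarith
  -- The left side has absolute value at most `8 + 8n`, less than `12n` as `n ≥ 3`; hence `|q| < 6`.
  refine ⟨q, ?_, ?_, hq⟩
  · by_contra! hc
    have : (n : ℤ) * q ≤ n * (-6) := mul_le_mul_of_nonneg_left (by omega) (by omega)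
    omega
  · by_contra! hc
    have : (n : ℤ) * 6 ≤ n * q := mul_le_mul_of_nonneg_left (by omega) (by omega)
    omega

lemma triv_eq_zero_of {n l : ℕ} (hl : l < n) (hn : 3 ≤ n) {a b : ℤ} (ha : |a| ≤ 8) (hb : |b| ≤ 8)
    (h : ∀ q : ℤ, -5 ≤ q → q ≤ 5 → a + b * l ≠ 2 * (n * q)) : triv (2 * n) l a b = 0 := by
  rcases triv_eq_zero_or (2 * n) l a b with h' | ⟨-, h'⟩
  · exact h'
  · obtain ⟨q, h1, h2, h3⟩ := exists_multiplier hl ha hb hn h'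
    exact absurd h3 (h q h1 h2)

lemma eq_of_triv {n l : ℕ} (hl : l < n) (hn : 3 ≤ n) {a b : ℤ} (ha : |a| ≤ 8) (hb : |b| ≤ 8)
    (h : triv (2 * n) l a b ≠ 0) : ∃ q : ℤ, -5 ≤ q ∧ q ≤ 5 ∧ a + b * l = 2 * (n * q) := by
  by_contra! hc
  exact h (triv_eq_zero_of hl hn ha hb hc)

end Counting

/-! ### Automorphisms preserve the spokes. -/

section Spokes

variable {m l : ℕ}

/-- If an arc invariant takes three not all equal values on the outer edges, the spokes and the inner
edges, then all automorphisms that preserve it preserve the spokes. -/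
lemma map_swap_of_invariant [NeZero m] {F : ZMod m ⊕ ZMod m → ZMod m ⊕ ZMod m → ℕ} {o s t : ℕ}
    (h2 : (2 : ZMod m) ≠ 0) (hl : (2 * l : ZMod m) ≠ 0)
    (hF : ∀ x y, (GP m l).Adj x y → (y = x.swap ∧ F x y = s) ∨
      (x.isLeft ∧ y.isLeft ∧ F x y = o) ∨ (x.isRight ∧ y.isRight ∧ F x y = t))
    (hne : ¬ (o = s ∧ s = t)) (φ : GP m l ≃g GP m l) (hφ : ∀ x y, F (φ x) (φ y) = F x y)
    (x : ZMod m ⊕ ZMod m) : φ x.swap = (φ x).swap := by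
  have adj : ∀ {x y}, (GP m l).Adj x y → (GP m l).Adj (φ x) (φ y) := fun h => φ.map_rel_iff.2 h
  have cross : ∀ {x y : ZMod m ⊕ ZMod m}, (GP m l).Adj x y → x.isLeft ≠ y.isLeft → y = x.swap := by
    rintro (x | x) (y | y) h h' <;> simp at h' ⊢
    · exact adj_inl_inr.1 h
    · exact adj_inr_inl.1 h
  -- If all three alternatives fail, each class of edges contains an edge mapped into another class.
  -- Each of the values `o`, `s`, `t` then equals another one of them, which forces all three to be
  -- equal.
  have key : (∀ i, (φ (Sum.inl i)).isLeft) ∨ (∀ i, (φ (Sum.inr i)).isRight) ∨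
      ∀ x, φ x.swap = (φ x).swap := by
    by_contra! hc
    obtain ⟨⟨i, hi⟩, ⟨j, hj⟩, ⟨x, hx⟩⟩ := hc
    have hs : s = o ∨ s = t := by
      have h1 := hF _ _ (adj_swap x)
      have h3 := hF _ _ (adj (adj_swap x))
      rw [hφ] at h3
      have : F x x.swap = s := by
        cases x <;> simp at h1 <;> exact h1
      rcases h3 with ⟨h, -⟩ | ⟨-, -, h⟩ | ⟨-, -, h⟩
      · exact absurd h hx
      · exact Or.inl (this.symm.trans h)
      · exact Or.inr (this.symm.trans h)
    have ho : o = s ∨ o = t := by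
      have ha : (GP m l).Adj (Sum.inl i) (Sum.inl (i + 1)) := (adj_inl_inl h2).2 (Or.inl rfl)
      have h1 := hF _ _ ha
      have h3 := hF _ _ (adj ha)
      rw [hφ] at h3
      simp at h1
      rw [h1] at h3
      rcases h3 with ⟨-, h⟩ | ⟨h, -⟩ | ⟨-, -, h⟩
      · exact Or.inl h
      · exact absurd h hi
      · exact Or.inr h
    have ht : t = s ∨ t = o := by
      have ha : (GP m l).Adj (Sum.inr j) (Sum.inr (j + l)) := (adj_inr_inr hl).2 (Or.inl rfl)
      have h1 := hF _ _ ha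
      have h3 := hF _ _ (adj ha)
      rw [hφ] at h3
      simp at h1
      rw [h1] at h3
      rcases h3 with ⟨-, h⟩ | ⟨-, -, h⟩ | ⟨h, -⟩
      · exact Or.inl h
      · exact Or.inr h
      · exact absurd h hj
    omega
  rcases key with h | h | h
  -- By finiteness the outer rim is mapped onto itself, hence so is the inner one; the spokes are
  -- the only edges between the rims.
  · have hex : ∀ i, ∃ j, φ (Sum.inl i) = Sum.inl j := fun i => Sum.isLeft_iff.1 (h i)
    choose f hf using hex
    have hinj : Function.Injective f := fun i j hij =>
      Sum.inl_injective (φ.injective (by rw [hf, hf, hij]))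
    have hsurj := Finite.surjective_of_injective hinj
    have hr : ∀ i, (φ (Sum.inr i)).isLeft = false := by
      intro i
      by_contra hc
      obtain ⟨j, hj⟩ := Sum.isLeft_iff.1 (Bool.not_eq_false _ ▸ hc)
      obtain ⟨a, rfl⟩ := hsurj j
      rw [← hf a] at hj
      simpa using φ.injective hj
    refine cross (adj (adj_swap x)) ?_
    rcases x with i | i <;> simp [h, hr]
  · have hex : ∀ i, ∃ j, φ (Sum.inr i) = Sum.inr j := fun i => Sum.isRight_iff.1 (h i)
    choose f hf using hex
    have hinj : Function.Injective f := fun i j hij =>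
      Sum.inr_injective (φ.injective (by rw [hf, hf, hij]))
    have hsurj := Finite.surjective_of_injective hinj
    have hr : ∀ i, (φ (Sum.inl i)).isLeft = true := by
      intro i
      by_contra hc
      obtain ⟨j, hj⟩ := Sum.isRight_iff.1 (by simpa using hc)
      obtain ⟨a, rfl⟩ := hsurj j
      rw [← hf a] at hj
      simpa using φ.injective hj
    refine cross (adj (adj_swap x)) ?_
    rcases x with i | i <;> simp [hf, hr]
  · exact h x

/-- The hypotheses `hS`, `hO`, `hI` say that the two directions of an edge have the same
displacements up to sign. They do not involve `m` or `l`, so for fixed `j` they are finite checks.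
-/
lemma turnCount_edge [NeZero m] [DecidableRel (GP m l).Adj]
    (h2 : (2 : ZMod m) ≠ 0) (hl : (2 * l : ZMod m) ≠ 0) {j : ℕ}
    (hS : ((returns j false none).map normDisp).Perm ((returns j true none).map normDisp))
    (hO : ((returns j true (some false)).map normDisp).Perm
      ((returns j true (some true)).map normDisp))
    (hI : ((returns j false (some false)).map normDisp).Perm
      ((returns j false (some true)).map normDisp))
    (x y : ZMod m ⊕ ZMod m) (hxy : (GP m l).Adj x y) :
    (y = x.swap ∧ turnCount (GP m l) x y j x y = trivialCount m l (returns j true none)) ∨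
      (x.isLeft ∧ y.isLeft ∧
        turnCount (GP m l) x y j x y = trivialCount m l (returns j true (some true))) ∨
      (x.isRight ∧ y.isRight ∧
        turnCount (GP m l) x y j x y = trivialCount m l (returns j false (some true))) := by
  obtain ⟨i, s, rfl⟩ : ∃ i s, x = vertexAt m l i (s, 0, 0) := by
    rcases x with i | i
    · exact ⟨i, true, by simp [vertexAt]⟩
    · exact ⟨i, false, by simp [vertexAt]⟩
  obtain ⟨c, rfl⟩ := (adj_vertexAt_iff h2 hl _ _ _).1 hxy
  rw [turnCount_eq_trivialCount h2 hl]
  rcases c with _ | _ | _ <;> cases s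
  · exact Or.inl ⟨by simp [vertexAt, moveStep], trivialCount_congr hS⟩
  · exact Or.inl ⟨by simp [vertexAt, moveStep], rfl⟩
  · exact Or.inr (Or.inr ⟨rfl, rfl, trivialCount_congr hI⟩)
  · exact Or.inr (Or.inl ⟨rfl, rfl, trivialCount_congr hO⟩)
  · exact Or.inr (Or.inr ⟨rfl, rfl, rfl⟩)
  · exact Or.inr (Or.inl ⟨rfl, rfl, rfl⟩)

lemma map_swap_of_trivialCount [NeZero m]
    (h2 : (2 : ZMod m) ≠ 0) (hl : (2 * l : ZMod m) ≠ 0) (j : ℕ)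
    (hj : j = 4 ∨ j = 8 ∨ j = 10)
    (hne : ¬ (trivialCount m l (returns j true (some true)) = trivialCount m l (returns j true none) ∧
      trivialCount m l (returns j true none) = trivialCount m l (returns j false (some true))))
    (φ : GP m l ≃g GP m l) (x : ZMod m ⊕ ZMod m) : φ x.swap = (φ x).swap := by
  classical
  refine map_swap_of_invariant (F := fun x y => turnCount (GP m l) x y j x y) h2 hl
    (turnCount_edge h2 hl ?_ ?_ ?_) hne φ (fun x y => turnCount_map _ φ x y j x y) x
  all_goals rcases hj with rfl | rfl | rfl <;> decide +kernel

lemma two_ne_zero_zmod {n : ℕ} (hn : 3 ≤ n) : (2 : ZMod (2 * n)) ≠ 0 := by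
  intro h
  have : ((2 : ℕ) : ZMod (2 * n)) = 0 := by exact_mod_cast h
  rw [ZMod.natCast_eq_zero_iff] at this
  have := Nat.le_of_dvd (by norm_num) this
  omega

lemma two_mul_ne_zero_zmod {n l : ℕ} (h0 : 0 < l) (hl : l < n) : (2 * l : ZMod (2 * n)) ≠ 0 := by
  intro h
  have : ((2 * l : ℕ) : ZMod (2 * n)) = 0 := by exact_mod_cast h
  rw [ZMod.natCast_eq_zero_iff] at this
  have := Nat.le_of_dvd (by omega) this
  omega

/-- The automorphisms of `GP(2n,l)` with `n` and `l` odd preserve the spokes, unless `(n,l)` is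
`(5,3)`. -/
theorem map_swap {n l : ℕ} (hn : Odd n) (hlo : Odd l) (hl : l < n) (hne : ¬ (n = 5 ∧ l = 3))
    (φ : GP (2 * n) l ≃g GP (2 * n) l) (x : ZMod (2 * n) ⊕ ZMod (2 * n)) :
    φ x.swap = (φ x).swap := by
  have h0 : 0 < l := hlo.pos
  have h3 : 3 ≤ n := by
    obtain ⟨a, rfl⟩ := hn
    omega
  have : NeZero (2 * n) := ⟨by omega⟩
  have h2 := two_ne_zero_zmod h3
  have hl2 := two_mul_ne_zero_zmod h0 hl
  -- Here `(2,-2)` is a trivial displacement, which the length-8 argument below excludes. The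
  -- quadrangles separate the classes instead: each spoke is in two of them, each outer edge in one.
  by_cases h1 : l = 1
  · subst h1
    refine map_swap_of_trivialCount h2 hl2 4 (Or.inl rfl) ?_ φ x
    have hO : trivialCount (2 * n) 1 (returns 4 true (some true)) =
        triv (2 * n) 1 1 1 + triv (2 * n) 1 1 (-1) + triv (2 * n) 1 4 0 := by
      rw [trivialCount_eq_sum]
      have : returns 4 true (some true) = [(1, 1), (1, -1), (4, 0)] := by decide +kernel
      simp [this, add_assoc]
    have hS : trivialCount (2 * n) 1 (returns 4 true none) =
        2 * triv (2 * n) 1 1 1 + 2 * triv (2 * n) 1 1 (-1) := by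
      rw [← trivialCount_map_normDisp, trivialCount_eq_sum]
      have : (returns 4 true none).map normDisp = [(1, 1), (1, -1), (1, -1), (1, 1)] := by
        decide +kernel
      simp [this]
      ring
    have e1 : triv (2 * n) 1 1 1 = 0 := by
      refine triv_eq_zero_of hl h3 (by norm_num) (by norm_num) fun q hq hq' h => ?_
      interval_cases q <;> omega
    have e2 : triv (2 * n) 1 4 0 = 0 := by
      refine triv_eq_zero_of hl h3 (by norm_num) (by norm_num) fun q hq hq' h => ?_
      interval_cases q <;> omega
    have e3 : triv (2 * n) 1 1 (-1) = 1 := by simp [triv]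
    rw [hO, hS, e1, e2, e3]
    omega
  -- In `GP(26,5)` both `1 + 5l` and `5 - l` vanish, and all three length-8 counts equal 8.
  by_cases h26 : n = 13 ∧ l = 5
  · obtain ⟨rfl, rfl⟩ := h26
    refine map_swap_of_trivialCount h2 hl2 10 (Or.inr (Or.inr rfl)) ?_ φ x
    decide +kernel
  refine map_swap_of_trivialCount h2 hl2 8 (Or.inr (Or.inl rfl)) ?_ φ x
  rw [trivialCount_outer, trivialCount_inner, trivialCount_spoke, triv_zero_zero]
  have hlt := hl
  obtain ⟨N, hN⟩ := hn
  obtain ⟨M, hM⟩ := hlo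
  have z : ∀ {a b : ℤ}, |a| ≤ 8 → |b| ≤ 8 →
      (∀ q : ℤ, -5 ≤ q → q ≤ 5 → a + b * l ≠ 2 * (n * q)) → triv (2 * n) l a b = 0 :=
    fun ha hb h => triv_eq_zero_of hl h3 ha hb h
  have z80 : triv (2 * n) l 8 0 = 0 :=
    z (by norm_num) (by norm_num) fun q hq hq' h => by interval_cases q <;> omega
  have z08 : triv (2 * n) l 0 8 = 0 :=
    z (by norm_num) (by norm_num) fun q hq hq' h => by interval_cases q <;> omega
  have z02 : triv (2 * n) l 0 2 = 0 :=
    z (by norm_num) (by norm_num) fun q hq hq' h => by interval_cases q <;> omega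
  have z20 : triv (2 * n) l 2 0 = 0 :=
    z (by norm_num) (by norm_num) fun q hq hq' h => by interval_cases q <;> omega
  have z22 : triv (2 * n) l 2 2 = 0 :=
    z (by norm_num) (by norm_num) fun q hq hq' h => by interval_cases q <;> omega
  have z22' : triv (2 * n) l 2 (-2) = 0 :=
    z (by norm_num) (by norm_num) fun q hq hq' h => by interval_cases q <;> omega
  rw [z80, z08, z02, z20, z22, z22']
  -- Adding both relations gives `n ∣ 3`, so `n = 3` and `l = 1`.
  have e33 : triv (2 * n) l 3 3 = 0 ∨ triv (2 * n) l 3 (-3) = 0 := by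
    by_contra! hc
    obtain ⟨q, q1, q2, hq⟩ := eq_of_triv hl h3 (by norm_num) (by norm_num) hc.1
    obtain ⟨r, r1, r2, hr⟩ := eq_of_triv hl h3 (by norm_num) (by norm_num) hc.2
    interval_cases q <;> interval_cases r <;> omega
  have e24 : (triv (2 * n) l 2 4 = 0 ∧ triv (2 * n) l 2 (-4) = 0) ∨
      (triv (2 * n) l 4 2 = 0 ∧ triv (2 * n) l 4 (-2) = 0) := by
    by_contra hc
    have hA : ∃ q : ℤ, -5 ≤ q ∧ q ≤ 5 ∧ (2 + 4 * l = 2 * (n * q) ∨ 2 - 4 * l = 2 * (n * q)) := by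
      by_cases h : triv (2 * n) l 2 4 = 0
      · have h' : triv (2 * n) l 2 (-4) ≠ 0 := fun h' => hc (Or.inl ⟨h, h'⟩)
        obtain ⟨q, q1, q2, hq⟩ := eq_of_triv hl h3 (by norm_num) (by norm_num) h'
        exact ⟨q, q1, q2, Or.inr (by omega)⟩
      · obtain ⟨q, q1, q2, hq⟩ := eq_of_triv hl h3 (by norm_num) (by norm_num) h
        exact ⟨q, q1, q2, Or.inl (by omega)⟩
    have hB : ∃ q : ℤ, -5 ≤ q ∧ q ≤ 5 ∧ (4 + 2 * l = 2 * (n * q) ∨ 4 - 2 * l = 2 * (n * q)) := by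
      by_cases h : triv (2 * n) l 4 2 = 0
      · have h' : triv (2 * n) l 4 (-2) ≠ 0 := fun h' => hc (Or.inr ⟨h, h'⟩)
        obtain ⟨q, q1, q2, hq⟩ := eq_of_triv hl h3 (by norm_num) (by norm_num) h'
        exact ⟨q, q1, q2, Or.inr (by omega)⟩
      · obtain ⟨q, q1, q2, hq⟩ := eq_of_triv hl h3 (by norm_num) (by norm_num) h
        exact ⟨q, q1, q2, Or.inl (by omega)⟩
    -- The relation for `r` forces `l = n - 2`. Then `n` divides `2l + 1` or `2l - 1`, hence 3 or 5,
    -- which leaves only `l = 1` and the exception `(5,3)`.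
    obtain ⟨q, q1, q2, hq⟩ := hA
    obtain ⟨r, r1, r2, hr⟩ := hB
    have hr1 : 0 ≤ r ∧ r ≤ 1 := by
      constructor <;> by_contra! <;> interval_cases r <;> omega
    obtain ⟨r3, r4⟩ := hr1
    interval_cases r <;> interval_cases q <;> omega
  have e15 : (triv (2 * n) l 1 5 = 0 ∧ triv (2 * n) l 1 (-5) = 0) ∨
      (triv (2 * n) l 5 1 = 0 ∧ triv (2 * n) l 5 (-1) = 0) := by
    by_contra hc
    have hA : ∃ q : ℤ, -5 ≤ q ∧ q ≤ 5 ∧ (1 + 5 * l = 2 * (n * q) ∨ 1 - 5 * l = 2 * (n * q)) := by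
      by_cases h : triv (2 * n) l 1 5 = 0
      · have h' : triv (2 * n) l 1 (-5) ≠ 0 := fun h' => hc (Or.inl ⟨h, h'⟩)
        obtain ⟨q, q1, q2, hq⟩ := eq_of_triv hl h3 (by norm_num) (by norm_num) h'
        exact ⟨q, q1, q2, Or.inr (by omega)⟩
      · obtain ⟨q, q1, q2, hq⟩ := eq_of_triv hl h3 (by norm_num) (by norm_num) h
        exact ⟨q, q1, q2, Or.inl (by omega)⟩
    have hB : ∃ q : ℤ, -5 ≤ q ∧ q ≤ 5 ∧ (5 + l = 2 * (n * q) ∨ 5 - l = 2 * (n * q)) := by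
      by_cases h : triv (2 * n) l 5 1 = 0
      · have h' : triv (2 * n) l 5 (-1) ≠ 0 := fun h' => hc (Or.inr ⟨h, h'⟩)
        obtain ⟨q, q1, q2, hq⟩ := eq_of_triv hl h3 (by norm_num) (by norm_num) h'
        exact ⟨q, q1, q2, Or.inr (by omega)⟩
      · obtain ⟨q, q1, q2, hq⟩ := eq_of_triv hl h3 (by norm_num) (by norm_num) h
        exact ⟨q, q1, q2, Or.inl (by omega)⟩
    -- With `l ≠ 1`, the relation for `r` forces `l = 5`. Then `2n` divides 26 or 24, which leaves
    -- only the exception `(13,5)`.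
    obtain ⟨q, q1, q2, hq⟩ := hA
    obtain ⟨r, r1, r2, hr⟩ := hB
    have hr1 : 0 ≤ r ∧ r ≤ 1 := by
      constructor <;> by_contra! <;> interval_cases r <;> omega
    obtain ⟨r3, r4⟩ := hr1
    interval_cases r <;> interval_cases q <;> omega
  have b33 : triv (2 * n) l 3 3 ≤ 1 := by rw [triv]; split_ifs <;> simp
  have b33' : triv (2 * n) l 3 (-3) ≤ 1 := by rw [triv]; split_ifs <;> simp
  -- Let `x, y, z, w, v` be the paired indicators of types `(1,5), (2,4), (3,3), (4,2), (5,1)`.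
  -- Equal counts give `x+y+z+w+v = 2` and `2(v-x) = y-w`. As `xv = yw = 0`, either only `z`
  -- survives and `z = 2`, against `e33`, or `3x + z = 2` or `3v + z = 2` with a positive `x` or
  -- `v`, which is impossible.
  omega

end Spokes

/-! ### Standard automorphisms and the classification of spoke-preserving ones. -/

section Automorphisms

variable {m l : ℕ}

/-- A permutation of the vertices that preserves the oriented edges up to orientation, and whose
inverse does so as well, is an automorphism. -/
def autOfEquiv (σ : Equiv.Perm (ZMod m ⊕ ZMod m))
    (h : ∀ x y, petersenRel m l x y → petersenRel m l (σ x) (σ y) ∨ petersenRel m l (σ y) (σ x))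
    (h' : ∀ x y, petersenRel m l x y →
      petersenRel m l (σ.symm x) (σ.symm y) ∨ petersenRel m l (σ.symm y) (σ.symm x)) :
    AutGroup (GP m l) where
  toEquiv := σ
  map_rel_iff' := by
    intro x y
    simp only [GP, SimpleGraph.fromRel_adj]
    refine and_congr (by simp) ⟨?_, ?_⟩
    · rintro (e | e)
      · simpa using h' _ _ e
      · simpa using (h' _ _ e).symm
    · rintro (e | e)
      · exact h _ _ e
      · exact (h _ _ e).symm

/-- The rotation as an automorphism. -/
def rotationAut (m l : ℕ) : AutGroup (GP m l) :=
  autOfEquiv (Equiv.sumCongr (Equiv.addRight 1) (Equiv.addRight 1))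
    (by
      rintro (x | x) (y | y) h <;> simp [petersenRel] at h ⊢ <;> rw [h] <;> left <;> ring)
    (by
      rintro (x | x) (y | y) h <;> simp [petersenRel] at h ⊢ <;> rw [h] <;> left <;> ring)

/-- The reflection as an automorphism. -/
def reflectionAut (m l : ℕ) : AutGroup (GP m l) :=
  autOfEquiv (Equiv.sumCongr (Equiv.neg _) (Equiv.neg _))
    (by
      rintro (x | x) (y | y) h <;> simp [petersenRel] at h ⊢ <;> rw [h] <;> right <;> ring)
    (by
      rintro (x | x) (y | y) h <;> simp [petersenRel] at h ⊢ <;> rw [h] <;> right <;> ring)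

/-- The exchange of the rims as a permutation. -/
def rimSwapEquiv (m l : ℕ) (h : ((l : ZMod m) * l) * (l * l) = 1) :
    Equiv.Perm (ZMod m ⊕ ZMod m) where
  toFun := rimSwap m l
  -- Multiplication by `l³` inverts multiplication by `l`, as `l⁴ = 1`.
  invFun
    | Sum.inl i => Sum.inr (l * l * l * i)
    | Sum.inr i => Sum.inl (l * l * l * i)
  left_inv := by
    rintro (i | i) <;> simp [rimSwap] <;> linear_combination i * h
  right_inv := by
    rintro (i | i) <;> simp [rimSwap] <;> linear_combination i * h

/-- The exchange of the rims as an automorphism. -/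
def rimSwapAut (m l : ℕ) (h : (l : ZMod m) ^ 2 = 1 ∨ (l : ZMod m) ^ 2 = -1) : AutGroup (GP m l) :=
  autOfEquiv (rimSwapEquiv m l (by
    rcases h with h | h
    · linear_combination (l ^ 2 + 1) * h
    · linear_combination (l ^ 2 - 1) * h))
    (by
      rintro (x | x) (y | y) e <;> simp [petersenRel, rimSwapEquiv, rimSwap] at e ⊢ <;> rw [e]
      · left; ring
      · rcases h with h | h
        · left; linear_combination h
        · right; linear_combination -h)
    (by
      rintro (x | x) (y | y) e <;> simp [petersenRel, rimSwapEquiv] at e ⊢ <;> rw [e]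
      · rcases h with h | h
        · left; linear_combination l * h
        · right; linear_combination -l * h
      · left
        rcases h with h | h
        · linear_combination (l ^ 2 + 1) * h
        · linear_combination (l ^ 2 - 1) * h)

lemma rotationAut_apply (x : ZMod m ⊕ ZMod m) : rotationAut m l x = rotation m x := by
  cases x <;> rfl

lemma reflectionAut_apply (x : ZMod m ⊕ ZMod m) : reflectionAut m l x = reflection m x := by
  cases x <;> rfl

lemma rimSwapAut_apply (h) (x : ZMod m ⊕ ZMod m) : rimSwapAut m l h x = rimSwap m l x := rfl

lemma rotationAut_pow_apply (j : ℕ) (x : ZMod m ⊕ ZMod m) :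
    (rotationAut m l ^ j) x = Sum.map (· + (j : ZMod m)) (· + (j : ZMod m)) x := by
  induction j with
  | zero => cases x <;> simp
  | succ j ih =>
    rw [pow_succ', RelIso.mul_apply, ih, rotationAut_apply]
    cases x <;> simp [rotation] <;> ring

lemma rotationAut_pow_self : rotationAut m l ^ m = 1 := by
  ext x
  rw [rotationAut_pow_apply]
  cases x <;> simp

lemma reflectionAut_sq : reflectionAut m l ^ 2 = 1 := by
  ext x
  rw [pow_two, RelIso.mul_apply, reflectionAut_apply, reflectionAut_apply]
  cases x <;> simp [reflection]

/-- A walk along a rim is mapped to a walk along a rim. -/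
lemma map_inl_of_map_swap [NeZero m] (h2 : (2 : ZMod m) ≠ 0) {φ : GP m l ≃g GP m l}
    (hφ : ∀ x, φ x.swap = (φ x).swap) {S : ZMod m → ZMod m ⊕ ZMod m} {d j : ZMod m}
    (hS : ∀ a y, (GP m l).Adj (S a) y → y ≠ (S a).swap → y = S (a + d) ∨ y = S (a - d))
    (h0 : φ (Sum.inl 0) = S j) :
    ∃ ε : ZMod m, (ε = 1 ∨ ε = -1) ∧ ∀ i, φ (Sum.inl i) = S (j + ε * (i * d)) := by
  have adj : ∀ i, (GP m l).Adj (φ (Sum.inl i)) (φ (Sum.inl (i + 1))) := fun i =>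
    φ.map_rel_iff.2 ((adj_inl_inl h2).2 (Or.inl rfl))
  have hns : ∀ i, φ (Sum.inl (i + 1)) ≠ (φ (Sum.inl i)).swap := by
    intro i h
    rw [← hφ] at h
    simpa using φ.injective h
  have hnb : ∀ i, φ (Sum.inl (i + 1 + 1)) ≠ φ (Sum.inl i) := by
    intro i h
    have := Sum.inl_injective (φ.injective h)
    exact h2 (by linear_combination this)
  obtain ⟨ε, hε, h1⟩ : ∃ ε : ZMod m, (ε = 1 ∨ ε = -1) ∧ φ (Sum.inl (0 + 1)) = S (j + ε * d) := by
    have ha := adj 0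
    have hs := hns 0
    rw [h0] at ha hs
    rcases hS _ _ ha hs with h | h
    · exact ⟨1, Or.inl rfl, by rw [h]; ring_nf⟩
    · exact ⟨-1, Or.inr rfl, by rw [h]; ring_nf⟩
  refine ⟨ε, hε, ?_⟩
  -- Two consecutive vertices are carried through the induction: the image path may neither use a
  -- spoke nor turn back, so the next vertex is forced.
  have key : ∀ t : ℕ, φ (Sum.inl (t : ZMod m)) = S (j + ε * (t * d)) ∧
      φ (Sum.inl ((t : ZMod m) + 1)) = S (j + ε * ((t + 1) * d)) := by
    intro t
    induction t with
    | zero =>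
      refine ⟨by simpa using h0, ?_⟩
      rw [Nat.cast_zero, h1]
      ring_nf
    | succ t ih =>
      push_cast
      refine ⟨ih.2, ?_⟩
      have ha := adj (t + 1)
      have hs := hns (t + 1)
      have hb := hnb t
      rw [ih.2] at ha hs
      rw [ih.1] at hb
      rcases hε with rfl | rfl <;> rcases hS _ _ ha hs with h | h
      · rw [h]; ring_nf
      · exact absurd (by rw [h]; ring_nf) hb
      · exact absurd (by rw [h]; ring_nf) hb
      · rw [h]; ring_nf
  intro i
  have := (key i.val).1
  rwa [ZMod.natCast_zmod_val] at this

/-- The automorphisms that preserve the spokes. -/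
theorem classification [NeZero m] (h2 : (2 : ZMod m) ≠ 0) (hl : (2 * l : ZMod m) ≠ 0)
    {φ : GP m l ≃g GP m l} (hφ : ∀ x, φ x.swap = (φ x).swap) :
    ∃ j ε : ZMod m, (ε = 1 ∨ ε = -1) ∧
      ((∀ i, φ (Sum.inl i) = Sum.inl (j + ε * i) ∧ φ (Sum.inr i) = Sum.inr (j + ε * i)) ∨
        ((l : ZMod m) ^ 2 = 1 ∨ (l : ZMod m) ^ 2 = -1) ∧
        ∀ i, φ (Sum.inl i) = Sum.inr (j + ε * (l * i)) ∧
          φ (Sum.inr i) = Sum.inl (j + ε * (l * i))) := by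
  rcases h0 : φ (Sum.inl 0) with j | j
  · obtain ⟨ε, hε, h⟩ := map_inl_of_map_swap (d := 1) h2 hφ (by
      rintro a (y | y) ha hs
      · simpa [adj_inl_inl h2] using ha
      · simp [adj_inl_inr] at ha hs
        exact absurd ha hs) h0
    refine ⟨j, ε, hε, Or.inl fun i => ?_⟩
    have h' := h i
    rw [mul_one] at h'
    refine ⟨h', ?_⟩
    have := hφ (Sum.inl i)
    rwa [h'] at this
  · obtain ⟨ε, hε, h⟩ := map_inl_of_map_swap (d := (l : ZMod m)) h2 hφ (by
      rintro a (y | y) ha hs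
      · simp [adj_inr_inl] at ha hs
        exact absurd ha hs
      · simpa [adj_inr_inr hl] using ha) h0
    have hb : ∀ i, φ (Sum.inr i) = Sum.inl (j + ε * (l * i)) := by
      intro i
      have := hφ (Sum.inl i)
      rwa [h, mul_comm i] at this
    refine ⟨j, ε, hε, Or.inr ⟨?_, fun i => ⟨by rw [h, mul_comm i], hb i⟩⟩⟩
    -- The inner edge `v_0 v_l` is mapped to `u_j` and `u_{j ± l²}`, whose adjacency forces `l² =
    -- ±1`.
    have ha : (GP m l).Adj (φ (Sum.inr 0)) (φ (Sum.inr (0 + (l : ZMod m)))) :=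
      φ.map_rel_iff.2 ((adj_inr_inr hl).2 (Or.inl rfl))
    rw [hb, hb, adj_inl_inl h2] at ha
    rcases hε with rfl | rfl <;> rcases ha with ha | ha
    · left; linear_combination ha
    · right; linear_combination ha
    · right; linear_combination -ha
    · left; linear_combination -ha

/-- The automorphisms that preserve the spokes, in terms of the standard generators. -/
theorem eq_mul_of_map_swap [NeZero m] (h2 : (2 : ZMod m) ≠ 0) (hl : (2 * l : ZMod m) ≠ 0)
    {φ : AutGroup (GP m l)} (hφ : ∀ x, φ x.swap = (φ x).swap) :
    ∃ j a : ℕ, φ = rotationAut m l ^ j * reflectionAut m l ^ a ∨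
      ∃ h, φ = rotationAut m l ^ j * reflectionAut m l ^ a * rimSwapAut m l h := by
  obtain ⟨j, ε, hε, h⟩ := classification h2 hl hφ
  have hδ : ∃ a : ℕ, ∀ i, (reflectionAut m l ^ a) (Sum.inl i) = Sum.inl (ε * i) ∧
      (reflectionAut m l ^ a) (Sum.inr i) = Sum.inr (ε * i) := by
    rcases hε with rfl | rfl
    · exact ⟨0, fun i => by simp⟩
    · exact ⟨1, fun i => by simp [reflectionAut_apply, reflection]⟩
  obtain ⟨a, ha⟩ := hδ
  refine ⟨j.val, a, ?_⟩
  rcases h with h | ⟨hs, h⟩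
  · left
    ext x
    rw [RelIso.mul_apply, rotationAut_pow_apply, ZMod.natCast_zmod_val]
    rcases x with i | i <;> simp [h, ha, add_comm]
  · refine Or.inr ⟨hs, ?_⟩
    ext x
    rw [RelIso.mul_apply, RelIso.mul_apply, rotationAut_pow_apply, ZMod.natCast_zmod_val,
      rimSwapAut_apply]
    rcases x with i | i <;> simp [h, ha, rimSwap, add_comm]

/-- The automorphisms that preserve the spokes commute with the half turn. -/
lemma commute_half_turn [NeZero m] (h2 : (2 : ZMod m) ≠ 0) (hl : (2 * l : ZMod m) ≠ 0)
    {φ : AutGroup (GP m l)} (hφ : ∀ x, φ x.swap = (φ x).swap) {c : ZMod m} (hc : -c = c)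
    (hlc : l * c = c) (x : ZMod m ⊕ ZMod m) :
    φ (Sum.map (· + c) (· + c) x) = Sum.map (· + c) (· + c) (φ x) := by
  obtain ⟨j, ε, hε, h⟩ := classification h2 hl hφ
  rcases h with h | ⟨-, h⟩ <;> rcases x with i | i <;>
    simp only [Sum.map_inl, Sum.map_inr, h, Sum.inl.injEq, Sum.inr.injEq] <;>
    rcases hε with rfl | rfl
  · ring
  · linear_combination hc
  · ring
  · linear_combination hc
  · linear_combination hlc
  · linear_combination hc - hlc
  · linear_combination hlc
  · linear_combination hc - hlc

end Automorphisms

/-! ### Normal forms in groups with a normalized cyclic factor. -/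

section NormalForms

variable {Γ : Type*} [Group Γ]

/-- A generator of finite order that is normalized by the other generators can be moved to the
left. -/
lemma exists_pow_mul_of_mem_closure {ρ : Γ} {m : ℕ} (hm : 0 < m) (hρ : ρ ^ m = 1) {T : Set Γ}
    (hT : ∀ t ∈ T, (∃ c : ℕ, t * ρ * t⁻¹ = ρ ^ c) ∧ ∃ c : ℕ, t⁻¹ * ρ * t = ρ ^ c) {x : Γ}
    (hx : x ∈ Subgroup.closure (insert ρ T)) :
    ∃ i : ℕ, ∃ z ∈ Subgroup.closure T, x = ρ ^ i * z := by
  have hinv : ρ⁻¹ = ρ ^ (m - 1) := by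
    rw [inv_eq_iff_mul_eq_one, ← pow_succ', Nat.sub_add_cancel hm, hρ]
  have move : ∀ {t : Γ} {c : ℕ}, t * ρ * t⁻¹ = ρ ^ c → ∀ i, t * ρ ^ i = ρ ^ (c * i) * t := by
    intro t c h i
    rw [pow_mul, ← h, conj_pow]
    group
  induction hx using Subgroup.closure_induction_left with
  | one => exact ⟨0, 1, one_mem _, by simp⟩
  | mul_left t ht y _ ih =>
    obtain ⟨i, z, hz, rfl⟩ := ih
    rcases ht with rfl | ht
    · exact ⟨i + 1, z, hz, by rw [pow_succ']; group⟩
    · obtain ⟨⟨c, hc⟩, -⟩ := hT t ht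
      refine ⟨c * i, t * z, mul_mem (Subgroup.subset_closure ht) hz, ?_⟩
      rw [← mul_assoc, move hc, mul_assoc]
  | inv_mul_cancel t ht y _ ih =>
    obtain ⟨i, z, hz, rfl⟩ := ih
    rcases ht with rfl | ht
    · exact ⟨m - 1 + i, z, hz, by rw [hinv, pow_add, mul_assoc]⟩
    · obtain ⟨-, ⟨c, hc⟩⟩ := hT t ht
      refine ⟨c * i, t⁻¹ * z, mul_mem (inv_mem (Subgroup.subset_closure ht)) hz, ?_⟩
      rw [← mul_assoc, move (by rwa [inv_inv]), mul_assoc]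

lemma exists_pow_of_mem_closure_singleton {δ : Γ} {m : ℕ} (hm : 0 < m) (hδ : δ ^ m = 1) {x : Γ}
    (hx : x ∈ Subgroup.closure {δ}) : ∃ a < m, x = δ ^ a := by
  obtain ⟨i, z, hz, rfl⟩ := exists_pow_mul_of_mem_closure (T := ∅) hm hδ (by simp) (by simpa using hx)
  obtain rfl : z = 1 := by simpa using hz
  exact ⟨i % m, Nat.mod_lt _ hm, by rw [mul_one]; exact pow_eq_pow_mod i hδ⟩

lemma conj_of_involution {ρ δ : Γ} {m : ℕ} (hm : 0 < m) (hρ : ρ ^ m = 1) (hδ : δ ^ 2 = 1)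
    (h : δ * ρ * δ * (ρ⁻¹)⁻¹ = 1) :
    (∃ c : ℕ, δ * ρ * δ⁻¹ = ρ ^ c) ∧ ∃ c : ℕ, δ⁻¹ * ρ * δ = ρ ^ c := by
  have hinv : ρ⁻¹ = ρ ^ (m - 1) := by
    rw [inv_eq_iff_mul_eq_one, ← pow_succ', Nat.sub_add_cancel hm, hρ]
  have hδ' : δ⁻¹ = δ := inv_eq_of_mul_eq_one_left (by rw [← pow_two, hδ])
  rw [mul_inv_eq_one, hinv] at h
  rw [hδ']
  exact ⟨⟨_, h⟩, _, h⟩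

end NormalForms

/-! ### The presented groups as automorphism groups. -/

section Presentations

variable {V : Type*}

/-- The automorphism group is transported along an isomorphism of graphs. -/
def autCongr {W : Type*} {G : SimpleGraph V} {H : SimpleGraph W} (e : G ≃g H) :
    AutGroup H ≃* AutGroup G where
  toFun φ := (e.trans φ).trans e.symm
  invFun φ := (e.symm.trans φ).trans e
  left_inv φ := by ext x; simp
  right_inv φ := by ext x; simp
  map_mul' φ ψ := by ext x; simp

variable {m l : ℕ}

lemma autIsPresented_of {G : SimpleGraph V} (e : G ≃g GP m l) {S : Type} {rels : Set (FreeGroup S)}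
    {act : S → ZMod m ⊕ ZMod m → ZMod m ⊕ ZMod m} (g : S → AutGroup (GP m l))
    (hg : ∀ s x, g s x = act s x) (hrels : ∀ r ∈ rels, FreeGroup.lift g r = 1)
    (hinj : ∀ x, PresentedGroup.toGroup hrels x = 1 → x = 1)
    (hsurj : ∀ φ, ∃ x, PresentedGroup.toGroup hrels x = φ) :
    AutIsPresented G m l rels act := by
  let f : PresentedGroup rels ≃* AutGroup (GP m l) :=
    MulEquiv.ofBijective (PresentedGroup.toGroup hrels)
      ⟨(injective_iff_map_eq_one _).2 hinj, hsurj⟩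
  refine ⟨e, f.trans (autCongr e), fun s x => ?_⟩
  rw [← hg]
  have : f (PresentedGroup.of s) = g s := PresentedGroup.toGroup.of hrels
  simp [autCongr, this]

lemma pow_eq_one_of_cast_eq_zero {i : ℕ} (hi : (i : ZMod m) = 0) {Γ : Type*} [Group Γ]
    {r : Γ} (hr : r ^ m = 1) : r ^ i = 1 := by
  obtain ⟨c, rfl⟩ := (ZMod.natCast_eq_zero_iff _ _).1 hi
  rw [pow_mul, hr, one_pow]

lemma rimSwapAut_sq (h) (x : ZMod m ⊕ ZMod m) :
    (rimSwapAut m l h ^ 2) x = Sum.map ((l : ZMod m) ^ 2 * ·) ((l : ZMod m) ^ 2 * ·) x := by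
  rw [pow_two, RelIso.mul_apply, rimSwapAut_apply, rimSwapAut_apply]
  cases x <;> simp [rimSwap] <;> ring

lemma reflection_mul_rotation :
    reflectionAut m l * rotationAut m l * reflectionAut m l * rotationAut m l = 1 := by
  ext x
  simp only [RelIso.mul_apply, rotationAut_apply, reflectionAut_apply]
  cases x <;> simp [rotation, reflection]

lemma rimSwap_mul_rotation (h) :
    rimSwapAut m l h * rotationAut m l = rotationAut m l ^ l * rimSwapAut m l h := by
  ext x
  simp only [RelIso.mul_apply, rotationAut_apply, rotationAut_pow_apply, rimSwapAut_apply]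
  cases x <;> simp [rotation, rimSwap] <;> ring

lemma rimSwap_mul_reflection (h) :
    rimSwapAut m l h * reflectionAut m l = reflectionAut m l * rimSwapAut m l h := by
  ext x
  simp only [RelIso.mul_apply, reflectionAut_apply, rimSwapAut_apply]
  cases x <;> simp [reflection, rimSwap]

lemma rimSwapAut_sq_eq_one (h) (h' : (l : ZMod m) ^ 2 = 1) : rimSwapAut m l h ^ 2 = 1 := by
  ext x
  rw [rimSwapAut_sq, h']
  cases x <;> simp

lemma rimSwapAut_sq_eq_reflection (h) (h' : (l : ZMod m) ^ 2 = -1) :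
    rimSwapAut m l h ^ 2 = reflectionAut m l := by
  ext x
  rw [rimSwapAut_sq, h', reflectionAut_apply]
  cases x <;> simp [reflection]

lemma eq_zero_of_rotation_mul_reflection (h2 : (2 : ZMod m) ≠ 0) {i a : ℕ} (ha : a < 2)
    (h : rotationAut m l ^ i * reflectionAut m l ^ a = 1) : (i : ZMod m) = 0 ∧ a = 0 := by
  have h0 := DFunLike.congr_fun h (Sum.inl 0)
  have h1 := DFunLike.congr_fun h (Sum.inl 1)
  rw [RelIso.mul_apply, rotationAut_pow_apply] at h0 h1
  interval_cases a
  · simpa using h0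
  -- The map sends `u_0` to `u_i` and `u_1` to `u_{i-1}`; fixing both would give `2 = 0`.
  · simp [reflectionAut_apply, reflection] at h0 h1
    exact absurd (by linear_combination h0 - h1) h2

lemma rotation_mul_reflection_mul_rimSwap_ne_one (h) (i a : ℕ) :
    rotationAut m l ^ i * reflectionAut m l ^ a * rimSwapAut m l h ≠ 1 := by
  have hδ : (reflectionAut m l ^ a) (Sum.inr 0) = Sum.inr 0 := by
    induction a with
    | zero => rfl
    | succ a ih =>
      rw [pow_succ', RelIso.mul_apply, ih]
      simp [reflectionAut_apply, reflection]
  intro e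
  have h0 := DFunLike.congr_fun e (Sum.inl 0)
  rw [RelIso.mul_apply, RelIso.mul_apply, rotationAut_pow_apply, rimSwapAut_apply] at h0
  simp [rimSwap, hδ] at h0

variable [NeZero m] {G : SimpleGraph V}

/-- Injectivity: the relations reduce every element to a normal form `ρ^i δ^a`, and a normal form
acting trivially is trivial. Surjectivity is `eq_mul_of_map_swap`. The other two presentations
follow the same pattern. -/
theorem autIsPresented_relsF (h2 : (2 : ZMod m) ≠ 0) (hl : (2 * l : ZMod m) ≠ 0)
    (hφ : ∀ (φ : GP m l ≃g GP m l) x, φ x.swap = (φ x).swap) (e : G ≃g GP m l)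
    (h : ¬ ((l : ZMod m) ^ 2 = 1 ∨ (l : ZMod m) ^ 2 = -1)) :
    AutIsPresented G m l (relsF m) (actF m) := by
  let g : GenF → AutGroup (GP m l) := fun s => GenF.casesOn s (rotationAut m l) (reflectionAut m l)
  have hrels : ∀ r ∈ relsF m, FreeGroup.lift g r = 1 := by
    rintro r (rfl | rfl | rfl)
    · simpa [g] using rotationAut_pow_self
    · simpa [g] using reflectionAut_sq
    · simpa [g] using reflection_mul_rotation
  refine autIsPresented_of e g ?_ hrels ?_ ?_
  · rintro (_ | _) x
    · exact rotationAut_apply x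
    · exact reflectionAut_apply x
  · intro x hx
    set ρ : PresentedGroup (relsF m) := PresentedGroup.of GenF.rho with hρ
    set δ : PresentedGroup (relsF m) := PresentedGroup.of GenF.delta with hδ
    have r1 : ρ ^ m = 1 := PresentedGroup.one_of_mem (rels := relsF m)
      (x := FreeGroup.of GenF.rho ^ m) (by simp [relsF])
    have r2 : δ ^ 2 = 1 := PresentedGroup.one_of_mem (rels := relsF m)
      (x := FreeGroup.of GenF.delta ^ 2) (by simp [relsF])
    have r3 : δ * ρ * δ * (ρ⁻¹)⁻¹ = 1 := PresentedGroup.one_of_mem (rels := relsF m)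
      (x := FreeGroup.of GenF.delta * FreeGroup.of GenF.rho * FreeGroup.of GenF.delta *
        ((FreeGroup.of GenF.rho)⁻¹)⁻¹) (by simp [relsF])
    have hmem : x ∈ Subgroup.closure (insert ρ {δ}) := by
      have hx : x ∈ Subgroup.closure (Set.range (PresentedGroup.of (rels := relsF m))) := by
        rw [PresentedGroup.closure_range_of]; trivial
      refine Subgroup.closure_mono ?_ hx
      rintro _ ⟨_ | _, rfl⟩ <;> simp [ρ, δ]
    have hδρ := conj_of_involution (NeZero.pos m) r1 r2 r3
    obtain ⟨i, z, hz, rfl⟩ := exists_pow_mul_of_mem_closure (NeZero.pos m) r1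
      (by rintro t rfl; exact hδρ) hmem
    obtain ⟨a, ha, rfl⟩ := exists_pow_of_mem_closure_singleton two_pos r2 hz
    have hx' : rotationAut m l ^ i * reflectionAut m l ^ a = 1 := by
      simpa [ρ, δ, g] using hx
    obtain ⟨hi, rfl⟩ := eq_zero_of_rotation_mul_reflection h2 ha hx'
    rw [pow_eq_one_of_cast_eq_zero hi r1, pow_zero, mul_one]
  · intro φ
    obtain ⟨j, a, rfl | ⟨h', -⟩⟩ := eq_mul_of_map_swap h2 hl (hφ φ)
    · refine ⟨PresentedGroup.of GenF.rho ^ j * PresentedGroup.of GenF.delta ^ a, ?_⟩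
      simp [g]
    · exact absurd h' h

theorem autIsPresented_relsJ (h2 : (2 : ZMod m) ≠ 0) (hl : (2 * l : ZMod m) ≠ 0)
    (hφ : ∀ (φ : GP m l ≃g GP m l) x, φ x.swap = (φ x).swap) (e : G ≃g GP m l)
    (h : (l : ZMod m) ^ 2 = 1) :
    AutIsPresented G m l (relsJ m l) (actJ m l) := by
  let g : GenJ → AutGroup (GP m l) := fun s =>
    GenJ.casesOn s (rotationAut m l) (reflectionAut m l) (rimSwapAut m l (Or.inl h))
  have hα : rimSwapAut m l (Or.inl h) ^ 2 = 1 := rimSwapAut_sq_eq_one _ h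
  have hrels : ∀ r ∈ relsJ m l, FreeGroup.lift g r = 1 := by
    rintro r (rfl | rfl | rfl | rfl | rfl | rfl)
    · simpa [g] using rotationAut_pow_self
    · simpa [g] using reflectionAut_sq
    · simpa [g] using hα
    · simpa [g] using reflection_mul_rotation
    · simp only [map_mul, map_inv, map_pow, FreeGroup.lift_apply_of, g]
      rw [rimSwap_mul_rotation, mul_assoc (_ ^ l), ← pow_two, hα, mul_one, mul_inv_cancel]
    · simp only [map_mul, map_inv, FreeGroup.lift_apply_of, g]
      rw [rimSwap_mul_reflection, mul_assoc (reflectionAut m l), ← pow_two, hα, mul_one,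
        mul_inv_cancel]
  refine autIsPresented_of e g ?_ hrels ?_ ?_
  · rintro (_ | _ | _) x
    · exact rotationAut_apply x
    · exact reflectionAut_apply x
    · exact rimSwapAut_apply _ x
  · intro x hx
    set ρ : PresentedGroup (relsJ m l) := PresentedGroup.of GenJ.rho with hρ
    set δ : PresentedGroup (relsJ m l) := PresentedGroup.of GenJ.delta with hδ
    set α : PresentedGroup (relsJ m l) := PresentedGroup.of GenJ.alpha with hα
    have r1 : ρ ^ m = 1 := PresentedGroup.one_of_mem (rels := relsJ m l)
      (x := FreeGroup.of GenJ.rho ^ m) (by simp [relsJ])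
    have r2 : δ ^ 2 = 1 := PresentedGroup.one_of_mem (rels := relsJ m l)
      (x := FreeGroup.of GenJ.delta ^ 2) (by simp [relsJ])
    have r3 : α ^ 2 = 1 := PresentedGroup.one_of_mem (rels := relsJ m l)
      (x := FreeGroup.of GenJ.alpha ^ 2) (by simp [relsJ])
    have r4 : δ * ρ * δ * (ρ⁻¹)⁻¹ = 1 := PresentedGroup.one_of_mem (rels := relsJ m l)
      (x := FreeGroup.of GenJ.delta * FreeGroup.of GenJ.rho * FreeGroup.of GenJ.delta *
        ((FreeGroup.of GenJ.rho)⁻¹)⁻¹) (by simp [relsJ])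
    have r5 : α * ρ * α * (ρ ^ l)⁻¹ = 1 := PresentedGroup.one_of_mem (rels := relsJ m l)
      (x := FreeGroup.of GenJ.alpha * FreeGroup.of GenJ.rho * FreeGroup.of GenJ.alpha *
        (FreeGroup.of GenJ.rho ^ l)⁻¹) (by simp [relsJ])
    have r6 : α * δ * α * δ⁻¹ = 1 := PresentedGroup.one_of_mem (rels := relsJ m l)
      (x := FreeGroup.of GenJ.alpha * FreeGroup.of GenJ.delta * FreeGroup.of GenJ.alpha *
        (FreeGroup.of GenJ.delta)⁻¹) (by simp [relsJ])
    have hmem : x ∈ Subgroup.closure (insert ρ {δ, α}) := by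
      have hx : x ∈ Subgroup.closure (Set.range (PresentedGroup.of (rels := relsJ m l))) := by
        rw [PresentedGroup.closure_range_of]; trivial
      refine Subgroup.closure_mono ?_ hx
      rintro _ ⟨_ | _ | _, rfl⟩ <;> simp [ρ, δ, α]
    have hα' : α⁻¹ = α := inv_eq_of_mul_eq_one_left (by rw [← pow_two, r3])
    have hδρ := conj_of_involution (NeZero.pos m) r1 r2 r4
    have hαρ : α * ρ * α = ρ ^ l := mul_inv_eq_one.1 r5
    have hαδ : α * δ * α = δ := mul_inv_eq_one.1 r6
    obtain ⟨i, z, hz, rfl⟩ := exists_pow_mul_of_mem_closure (NeZero.pos m) r1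
      (by
        rintro t (rfl | rfl)
        · exact hδρ
        · rw [hα']
          exact ⟨⟨l, hαρ⟩, l, hαρ⟩) hmem
    obtain ⟨a', z, hz', rfl⟩ := exists_pow_mul_of_mem_closure two_pos r2
      (by
        rintro t rfl
        rw [hα']
        exact ⟨⟨1, by rw [hαδ, pow_one]⟩, 1, by rw [hαδ, pow_one]⟩) hz
    obtain ⟨b, hb, rfl⟩ := exists_pow_of_mem_closure_singleton two_pos r3 hz'
    obtain ⟨a, ha, haa⟩ : ∃ a < 2, δ ^ a' = δ ^ a :=
      ⟨a' % 2, Nat.mod_lt _ two_pos, pow_eq_pow_mod a' r2⟩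
    rw [haa] at hx ⊢
    have hx' : rotationAut m l ^ i * reflectionAut m l ^ a * rimSwapAut m l (Or.inl h) ^ b = 1 := by
      simpa [ρ, δ, α, g, mul_assoc] using hx
    interval_cases b
    · rw [pow_zero, mul_one] at hx'
      obtain ⟨hi, rfl⟩ := eq_zero_of_rotation_mul_reflection h2 ha hx'
      rw [pow_eq_one_of_cast_eq_zero hi r1, pow_zero, pow_zero, mul_one, mul_one]
    · rw [pow_one] at hx'
      exact absurd hx' (rotation_mul_reflection_mul_rimSwap_ne_one _ _ _)
  · intro φ
    obtain ⟨j, a, rfl | ⟨h', rfl⟩⟩ := eq_mul_of_map_swap h2 hl (hφ φ)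
    · refine ⟨PresentedGroup.of GenJ.rho ^ j * PresentedGroup.of GenJ.delta ^ a, ?_⟩
      simp [g]
    · refine ⟨PresentedGroup.of GenJ.rho ^ j * PresentedGroup.of GenJ.delta ^ a *
        PresentedGroup.of GenJ.alpha, ?_⟩
      simp [g]

theorem autIsPresented_relsH (h2 : (2 : ZMod m) ≠ 0) (hl : (2 * l : ZMod m) ≠ 0)
    (hφ : ∀ (φ : GP m l ≃g GP m l) x, φ x.swap = (φ x).swap) (e : G ≃g GP m l)
    (h : (l : ZMod m) ^ 2 = -1) :
    AutIsPresented G m l (relsH m l) (actH m l) := by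
  let g : GenH → AutGroup (GP m l) := fun s =>
    GenH.casesOn s (rotationAut m l) (rimSwapAut m l (Or.inr h))
  have hα : rimSwapAut m l (Or.inr h) ^ 2 = reflectionAut m l := rimSwapAut_sq_eq_reflection _ h
  have hrels : ∀ r ∈ relsH m l, FreeGroup.lift g r = 1 := by
    rintro r (rfl | rfl | rfl)
    · simpa [g] using rotationAut_pow_self
    · simp only [map_pow, FreeGroup.lift_apply_of, g]
      rw [show 4 = 2 * 2 from rfl, pow_mul, hα, reflectionAut_sq]
    · simp only [map_mul, map_inv, map_pow, FreeGroup.lift_apply_of, g]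
      rw [rimSwap_mul_rotation, mul_inv_cancel_right, mul_inv_cancel]
  refine autIsPresented_of e g ?_ hrels ?_ ?_
  · rintro (_ | _) x
    · exact rotationAut_apply x
    · exact rimSwapAut_apply _ x
  · intro x hx
    set ρ : PresentedGroup (relsH m l) := PresentedGroup.of GenH.rho with hρ
    set α : PresentedGroup (relsH m l) := PresentedGroup.of GenH.alpha with hα
    have r1 : ρ ^ m = 1 := PresentedGroup.one_of_mem (rels := relsH m l)
      (x := FreeGroup.of GenH.rho ^ m) (by simp [relsH])
    have r2 : α ^ 4 = 1 := PresentedGroup.one_of_mem (rels := relsH m l)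
      (x := FreeGroup.of GenH.alpha ^ 4) (by simp [relsH])
    have r3 : α * ρ * α⁻¹ * (ρ ^ l)⁻¹ = 1 := PresentedGroup.one_of_mem (rels := relsH m l)
      (x := FreeGroup.of GenH.alpha * FreeGroup.of GenH.rho * (FreeGroup.of GenH.alpha)⁻¹ *
        (FreeGroup.of GenH.rho ^ l)⁻¹) (by simp [relsH])
    have hmem : x ∈ Subgroup.closure (insert ρ {α}) := by
      have hx : x ∈ Subgroup.closure (Set.range (PresentedGroup.of (rels := relsH m l))) := by
        rw [PresentedGroup.closure_range_of]; trivial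
      refine Subgroup.closure_mono ?_ hx
      rintro _ ⟨_ | _, rfl⟩ <;> simp [ρ, α]
    have hαρ : α * ρ * α⁻¹ = ρ ^ l := mul_inv_eq_one.1 r3
    have hconj : ∀ c : ℕ, α * ρ ^ c * α⁻¹ = ρ ^ (l * c) := fun c => by
      rw [← conj_pow, hαρ, pow_mul]
    -- As `α⁻¹ = α³`, conjugation by `α⁻¹` raises `ρ` to the power `l³`.
    have hαρ' : α⁻¹ * ρ * α = ρ ^ (l * (l * l)) := by
      rw [← hconj, ← hconj, ← hαρ]
      have e : α * α * α * α = 1 := by rw [← r2]; simp [pow_succ]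
      have e' : α⁻¹ = α * α * α := inv_eq_of_mul_eq_one_left e
      have e'' : α = α⁻¹ * α⁻¹ * α⁻¹ := by
        rw [← mul_inv_rev, ← mul_inv_rev, ← mul_assoc, ← e', inv_inv]
      calc α⁻¹ * ρ * α = (α * α * α) * ρ * (α⁻¹ * α⁻¹ * α⁻¹) := by rw [← e', ← e'']
        _ = _ := by group
    obtain ⟨i, z, hz, rfl⟩ := exists_pow_mul_of_mem_closure (NeZero.pos m) r1
      (by rintro t rfl; exact ⟨⟨l, hαρ⟩, _, hαρ'⟩) hmem
    obtain ⟨b, hb, rfl⟩ := exists_pow_of_mem_closure_singleton four_pos r2 hz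
    have hx' : rotationAut m l ^ i * rimSwapAut m l (Or.inr h) ^ b = 1 := by
      simpa [ρ, α, g] using hx
    -- Since `α²` acts as the reflection, even `b` reduces to `ρ^i δ^a`, while odd `b` exchanges the
    -- rims and cannot act trivially.
    interval_cases b
    · obtain ⟨hi, -⟩ := eq_zero_of_rotation_mul_reflection (l := l) (a := 0) h2 two_pos
        (by simpa using hx')
      rw [pow_eq_one_of_cast_eq_zero hi r1, pow_zero, mul_one]
    · exact absurd (by simpa using hx')
        (rotation_mul_reflection_mul_rimSwap_ne_one (Or.inr h) i 0)
    · rw [rimSwapAut_sq_eq_reflection _ h] at hx'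
      obtain ⟨-, h1⟩ := eq_zero_of_rotation_mul_reflection (l := l) (a := 1) h2 one_lt_two
        (by simpa using hx')
      exact absurd h1 one_ne_zero
    · rw [pow_succ, rimSwapAut_sq_eq_reflection _ h, ← mul_assoc] at hx'
      exact absurd (by simpa using hx')
        (rotation_mul_reflection_mul_rimSwap_ne_one (Or.inr h) i 1)
  · intro φ
    obtain ⟨j, a, rfl | ⟨h', rfl⟩⟩ := eq_mul_of_map_swap h2 hl (hφ φ)
    · refine ⟨PresentedGroup.of GenH.rho ^ j * (PresentedGroup.of GenH.alpha ^ 2) ^ a, ?_⟩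
      simp [g, hα]
    · refine ⟨PresentedGroup.of GenH.rho ^ j * (PresentedGroup.of GenH.alpha ^ 2) ^ a *
        PresentedGroup.of GenH.alpha, ?_⟩
      simp [g, hα]

end Presentations

/-! ### A criterion for stability. -/

section Stability

variable {V : Type*} {G : SimpleGraph V}

/-- A connected graph is stable if all automorphisms of its canonical double cover commute with the
exchange of the two sheets. -/
theorem isStable_of_commute [Nonempty V]
    (hG : ∀ s : V → ZMod 2, (∀ x y, G.Adj x y → s x = s y) → ∀ x y, s x = s y)
    (hA : ∀ (φ : AutGroup (doubleCover G)) x t, φ (x, t + 1) = ((φ (x, t)).1, (φ (x, t)).2 + 1)) :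
    IsStable G := by
  have two : ∀ t : ZMod 2, t = 0 ∨ t = 0 + 1 := by decide
  have ne_one : ∀ a b : ZMod 2, a ≠ b + 1 → a = b := by decide
  have ne_self : ∀ a : ZMod 2, a ≠ a + 1 := by decide
  constructor
  · refine (injective_iff_map_eq_one _).2 fun p hp => ?_
    have h : ∀ x t, (p.1 x, t + p.2.toAdd) = (x, t) := fun x t => DFunLike.congr_fun hp (x, t)
    obtain ⟨x⟩ := ‹Nonempty V›
    refine Prod.ext ?_ ?_
    · ext y
      exact congrArg Prod.fst (h y 0)
    · simpa using congrArg Prod.snd (h x 0)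
  · intro φ
    have key : ∀ ψ : AutGroup (doubleCover G), ∃ c, ∀ x t, ψ (x, t) = ((ψ (x, 0)).1, c + t) := by
      intro ψ
      -- For adjacent `x`, `y`, the images of `(x,0)` and `(y,1)` lie on different sheets, and the
      -- image of `(y,0)` is opposite to that of `(y,1)`. Connectedness, in the form `hG`, spreads
      -- the equality.
      have hs : ∀ x y, (ψ (x, 0)).2 = (ψ (y, 0)).2 := by
        refine hG (fun x => (ψ (x, 0)).2) fun x y hxy => ?_
        have h : (doubleCover G).Adj (ψ (x, 0)) (ψ (y, 0 + 1)) :=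
          ψ.map_rel_iff.2 ⟨hxy, ne_self 0⟩
        rw [hA] at h
        exact ne_one _ _ h.2
      obtain ⟨z⟩ := ‹Nonempty V›
      refine ⟨(ψ (z, 0)).2, fun x t => ?_⟩
      rcases two t with rfl | rfl
      · rw [add_zero, hs z x]
      · rw [hA, hs z x, zero_add]
    obtain ⟨c, hc⟩ := key φ
    obtain ⟨d, hd⟩ := key φ.symm
    have hl : ∀ x, (φ.symm ((φ (x, 0)).1, 0)).1 = x := by
      intro x
      have h := hc x (-c)
      rw [add_neg_cancel] at h
      rw [← h]
      simp
    have hr : ∀ x, (φ ((φ.symm (x, 0)).1, 0)).1 = x := by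
      intro x
      have h := hd x (-d)
      rw [add_neg_cancel] at h
      rw [← h]
      simp
    have hadj : ∀ x y, G.Adj (φ (x, 0)).1 (φ (y, 0)).1 ↔ G.Adj x y := by
      intro x y
      have h : (doubleCover G).Adj (φ (x, 0)) (φ (y, 0 + 1)) ↔ (doubleCover G).Adj (x, 0) (y, 0 + 1) :=
        φ.map_rel_iff
      rw [hA, hc x 0, hc y 0] at h
      simpa [doubleCover] using h
    refine ⟨(⟨⟨fun x => (φ (x, 0)).1, fun x => (φ.symm (x, 0)).1, hl, hr⟩, hadj _ _⟩,
      Multiplicative.ofAdd c), ?_⟩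
    ext ⟨x, t⟩
    · rw [hc x t]
      rfl
    · rw [hc x t, add_comm]
      rfl

lemma eq_of_adj_GP {n k : ℕ} [NeZero n] (h2 : (2 : ZMod n) ≠ 0) (s : ZMod n ⊕ ZMod n → ZMod 2)
    (hs : ∀ x y, (GP n k).Adj x y → s x = s y) (x y : ZMod n ⊕ ZMod n) : s x = s y := by
  have h0 : ∀ t : ℕ, s (Sum.inl (t : ZMod n)) = s (Sum.inl 0) := by
    intro t
    induction t with
    | zero => simp
    | succ t ih =>
      rw [← ih]
      exact (hs _ _ ((adj_inl_inl h2).2 (Or.inl (by push_cast; ring)))).symm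
  have h1 : ∀ i, s (Sum.inl i) = s (Sum.inl 0) := fun i => by
    rw [← h0 i.val, ZMod.natCast_zmod_val]
  have h3 : ∀ x, s x = s (Sum.inl 0) := by
    rintro (i | i)
    · exact h1 i
    · exact (hs _ _ (adj_inr_inl.2 rfl)).trans (h1 i)
  rw [h3, h3 y]

end Stability

/-! ### The double cover as a generalized Petersen graph. -/

section Cover

variable {n k l : ℕ}

/-- The Chinese remainder isomorphism. -/
noncomputable def crt (hn : Odd n) : ZMod 2 × ZMod n ≃+* ZMod (2 * n) :=
  (ZMod.chineseRemainder hn.coprime_two_left).symm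

/-- The bijection between the vertices of `DGP(n,k)` and those of `GP(2n,l)`. -/
noncomputable def coverEquiv (hn : Odd n) :
    (ZMod n ⊕ ZMod n) × ZMod 2 ≃ ZMod (2 * n) ⊕ ZMod (2 * n) where
  toFun
    | (Sum.inl i, t) => Sum.inl (crt hn (t, i))
    -- The shift by one sheet compensates the sheet change along a spoke, so that spokes join equal
    -- subscripts.
    | (Sum.inr i, t) => Sum.inr (crt hn (t + 1, i))
  invFun
    | Sum.inl c => (Sum.inl ((crt hn).symm c).2, ((crt hn).symm c).1)
    | Sum.inr c => (Sum.inr ((crt hn).symm c).2, ((crt hn).symm c).1 - 1)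
  left_inv := by rintro ⟨_ | _, _⟩ <;> simp
  right_inv := by rintro (_ | _) <;> simp

lemma natCast_eq_crt (hn : Odd n) (hl : Odd l) : (l : ZMod (2 * n)) = crt hn (1, l) := by
  rw [← map_natCast (crt hn)]
  congr 1
  exact Prod.ext (by simpa using (ZMod.natCast_eq_one_iff_odd).2 hl) rfl

/-- The canonical double cover of a generalized Petersen graph of odd order. -/
noncomputable def coverIso (hn : Odd n) (hl : Odd l) (h2 : (2 : ZMod n) ≠ 0)
    (hk : (2 * k : ZMod n) ≠ 0) (h2' : (2 : ZMod (2 * n)) ≠ 0) (hl' : (2 * l : ZMod (2 * n)) ≠ 0)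
    (hlk : (l : ZMod n) = k ∨ (l : ZMod n) = -k) : DGP n k ≃g GP (2 * n) l where
  toEquiv := coverEquiv hn
  map_rel_iff' := by
    have e1 : ∀ s t : ZMod 2, s ≠ t ↔ t = s + 1 := by decide
    have e4 : ∀ s : ZMod 2, s - 1 = s + 1 := by decide
    have hadd : ∀ a b c, crt hn a = crt hn b + crt hn c ↔ a = b + c := fun a b c => by
      rw [← map_add, (crt hn).injective.eq_iff]
    have hsub : ∀ a b c, crt hn a = crt hn b - crt hn c ↔ a = b - c := fun a b c => by
      rw [← map_sub, (crt hn).injective.eq_iff]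
    rintro ⟨i | i, s⟩ ⟨j | j, t⟩
    · simp only [coverEquiv, Equiv.coe_fn_mk, doubleCover, adj_inl_inl h2, adj_inl_inl h2',
        ← map_one (crt hn), hadd, hsub, Prod.ext_iff, Prod.fst_add, Prod.snd_add, Prod.fst_sub,
        Prod.snd_sub, Prod.fst_one, Prod.snd_one, e4, e1]
      tauto
    · simp only [coverEquiv, Equiv.coe_fn_mk, doubleCover, adj_inl_inr, (crt hn).injective.eq_iff,
        Prod.ext_iff, e1]
      have : t + 1 = s ↔ t = s + 1 := by revert s t; decide
      tauto
    · simp only [coverEquiv, Equiv.coe_fn_mk, doubleCover, adj_inr_inl, (crt hn).injective.eq_iff,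
        Prod.ext_iff, e1]
      tauto
    · simp only [coverEquiv, Equiv.coe_fn_mk, doubleCover, adj_inr_inr hk, adj_inr_inr hl',
        natCast_eq_crt hn hl, hadd, hsub, Prod.ext_iff, Prod.fst_add, Prod.snd_add, Prod.fst_sub,
        Prod.snd_sub, e4, e1, add_left_inj]
      rcases hlk with h | h <;> simp only [h, sub_neg_eq_add, ← sub_eq_add_neg] <;> tauto

/-- The generalized Petersen graph is stable if the automorphisms of its canonical double cover
preserve the spokes. -/
theorem isStable_GP [NeZero n] (hn : Odd n) (hl : Odd l) (h2 : (2 : ZMod n) ≠ 0)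
    (hk : (2 * k : ZMod n) ≠ 0) (h2' : (2 : ZMod (2 * n)) ≠ 0) (hl' : (2 * l : ZMod (2 * n)) ≠ 0)
    (hlk : (l : ZMod n) = k ∨ (l : ZMod n) = -k)
    (hφ : ∀ (φ : GP (2 * n) l ≃g GP (2 * n) l) x, φ x.swap = (φ x).swap) : IsStable (GP n k) := by
  refine isStable_of_commute (eq_of_adj_GP h2) fun φ x t => ?_
  set e := coverIso hn hl h2 hk h2' hl' hlk
  -- This is the class of `n` modulo `2n`, and adding it changes the sheet. It is fixed by negation
  -- and, `l` being odd, by multiplication by `l`.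
  set c : ZMod (2 * n) := crt hn (1, 0) with hc
  have he : ∀ x t, e (x, t + 1) = Sum.map (· + c) (· + c) (e (x, t)) := by
    rintro (x | x) t
    · change Sum.inl (crt hn _) = Sum.inl (crt hn _ + c)
      rw [hc, ← map_add]
      simp
    · change Sum.inr (crt hn _) = Sum.inr (crt hn _ + c)
      rw [hc, ← map_add]
      simp
  have h := commute_half_turn h2' hl' (φ := (e.symm.trans φ).trans e) (hφ _) (c := c)
    (by rw [hc, ← map_neg]; congr 1; simp)
    (by rw [hc, natCast_eq_crt hn hl, ← map_mul]; congr 1; simp) (e (x, t))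
  rw [← he] at h
  apply e.injective
  have e1 : ∀ y, ((e.symm.trans φ).trans e) (e y) = e (φ y) := fun y => by simp
  rw [e1, e1] at h
  rw [h, ← he]

/-- Modulo 2 both sides of the second equation are 1, so only the congruence modulo `n` remains. -/
lemma sq_eq_iff (hn : Odd n) (hl : Odd l) (hlk : (l : ZMod n) = k ∨ (l : ZMod n) = -k) (ε : ℤ)
    (hε : (ε : ZMod 2) = 1) : (k : ℤ) ^ 2 ≡ ε [ZMOD n] ↔ (l : ZMod (2 * n)) ^ 2 = ε := by
  have hsq : (l : ZMod n) ^ 2 = k ^ 2 := by rcases hlk with h | h <;> rw [h]; ring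
  rw [← ZMod.intCast_eq_intCast_iff, natCast_eq_crt hn hl, ← map_intCast (crt hn), ← map_pow,
    (crt hn).injective.eq_iff, Prod.ext_iff]
  simp [hε, hsq]

end Cover

/-! ### The Petersen graph. -/

section Petersen

instance (n k : ℕ) : DecidableRel (petersenRel n k)
  | Sum.inl i, Sum.inl j => decEq j (i + 1)
  | Sum.inl i, Sum.inr j => decEq j i
  | Sum.inr i, Sum.inr j => decEq j (i + (k : ZMod n))
  | Sum.inr _, Sum.inl _ => instDecidableFalse

instance (n k : ℕ) : DecidableRel (GP n k).Adj := fun x y =>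
  decidable_of_iff (x ≠ y ∧ (petersenRel n k x y ∨ petersenRel n k y x))
    (SimpleGraph.fromRel_adj _ _ _).symm

/-- Distinct vertices of the Petersen graph are joined by a walk of length three, and the graph has no
triangle. -/
lemma petersen_walk_three (x y : ZMod 5 ⊕ ZMod 5) :
    (∃ a, (GP 5 2).Adj x a ∧ ∃ b, (GP 5 2).Adj a b ∧ (GP 5 2).Adj b y) ↔ x ≠ y := by
  revert x y
  decide +kernel

lemma petersen_walk_four (x y : ZMod 5 ⊕ ZMod 5) :
    ∃ a, (GP 5 2).Adj x a ∧ ∃ b, (GP 5 2).Adj a b ∧ ∃ c, (GP 5 2).Adj b c ∧ (GP 5 2).Adj c y := by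
  revert x y
  decide +kernel

/-- The vertices of the Petersen graph as pairs. -/
def pairLabel : ZMod 5 ⊕ ZMod 5 → Finset (Fin 5)
  | Sum.inl i => {2 * i, 2 * i + 1}
  | Sum.inr i => {2 * i + 2, 2 * i + 4}

lemma pairLabel_adj (x y : ZMod 5 ⊕ ZMod 5) :
    (GP 5 2).Adj x y ↔ Disjoint (pairLabel x) (pairLabel y) := by
  revert x y
  decide +kernel

lemma pairLabel_injective : Function.Injective pairLabel := by
  unfold Function.Injective
  decide +kernel

lemma pairLabel_card (x : ZMod 5 ⊕ ZMod 5) : (pairLabel x).card = 2 := by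
  revert x
  decide +kernel

lemma exists_pairLabel (s : Finset (Fin 5)) (hs : s.card = 2) : ∃ x, pairLabel x = s := by
  revert s
  decide +kernel

lemma exists_inter_pairLabel (a : Fin 5) : ∃ x y, pairLabel x ∩ pairLabel y = {a} := by
  revert a
  decide +kernel

/-- The 3-arcs of the Petersen graph. -/
def petersenArcs : Finset ((ZMod 5 ⊕ ZMod 5) × (ZMod 5 ⊕ ZMod 5) × (ZMod 5 ⊕ ZMod 5) ×
    (ZMod 5 ⊕ ZMod 5)) :=
  Finset.univ.filter fun p => (GP 5 2).Adj p.1 p.2.1 ∧ (GP 5 2).Adj p.2.1 p.2.2.1 ∧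
    p.1 ≠ p.2.2.1 ∧ (GP 5 2).Adj p.2.2.1 p.2.2.2 ∧ p.2.1 ≠ p.2.2.2

lemma card_petersenArcs : petersenArcs.card = 120 := by
  decide +kernel

lemma outer_mem_petersenArcs :
    (Sum.inl 0, Sum.inl 1, Sum.inl 2, Sum.inl 3) ∈ petersenArcs := by
  decide +kernel

lemma petersen_common_neighbor (x : ZMod 5 ⊕ ZMod 5) (h : (GP 5 2).Adj (Sum.inl 3) x)
    (h' : (GP 5 2).Adj x (Sum.inl 0)) : x = Sum.inl 4 := by
  revert x
  decide +kernel

/-- The spoke argument is not available for `GP(10,3)`. Instead, `(x,t+1)` is the only vertex of the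
opposite part with no walk of length three from `(x,t)`, so automorphisms preserve this pairing.
Walks of length four connect any two vertices of one part, which shows that the parts are not mixed.
-/
theorem isStable_petersen : IsStable (GP 5 2) := by
  refine isStable_of_commute (eq_of_adj_GP (by decide)) fun φ x t => ?_
  have parity : ∀ {p q : (ZMod 5 ⊕ ZMod 5) × ZMod 2}, (DGP 5 2).Adj p q → q.2 = p.2 + 1 := by
    have : ∀ a b : ZMod 2, a ≠ b → b = a + 1 := by decide
    exact fun {p q} h => this p.2 q.2 (And.right h)
  have two : ∀ a b : ZMod 2, b = a ∨ b = a + 1 := by decide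
  have ne_self : ∀ a : ZMod 2, a ≠ a + 1 := by decide
  have cancel : ∀ a : ZMod 2, a + 1 + 1 = a := by decide
  have pull : ∀ {p q : (ZMod 5 ⊕ ZMod 5) × ZMod 2}, (DGP 5 2).Adj p q → (DGP 5 2).Adj (φ.symm p) (φ.symm q) :=
    fun h => φ.symm.map_rel_iff.2 h
  rcases hp : φ (x, t) with ⟨y, a⟩
  rcases hq : φ (x, t + 1) with ⟨z, b⟩
  have hp' : φ.symm (y, a) = (x, t) := by rw [← hp]; simp
  have hq' : φ.symm (z, b) = (x, t + 1) := by rw [← hq]; simp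
  rcases two a b with rfl | rfl
  · exfalso
    obtain ⟨c, h1, d, h2, e, h3, h4⟩ := petersen_walk_four y z
    have g1 := pull (p := (y, b)) (q := (c, b + 1)) ⟨h1, ne_self b⟩
    have g2 := pull (p := (c, b + 1)) (q := (d, b)) ⟨h2, (ne_self b).symm⟩
    have g3 := pull (p := (d, b)) (q := (e, b + 1)) ⟨h3, ne_self b⟩
    have g4 := pull (p := (e, b + 1)) (q := (z, b)) ⟨h4, (ne_self b).symm⟩
    have := parity g4
    rw [parity g3, parity g2, parity g1, hp', hq', cancel, cancel] at this
    exact ne_self t this.symm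
  · by_contra hne
    have hyz : y ≠ z := by
      rintro rfl
      exact hne rfl
    obtain ⟨c, h1, d, h2, h3⟩ := (petersen_walk_three y z).2 hyz
    have g1 := pull (p := (y, a)) (q := (c, a + 1)) ⟨h1, ne_self a⟩
    have g2 := pull (p := (c, a + 1)) (q := (d, a)) ⟨h2, (ne_self a).symm⟩
    have g3 := pull (p := (d, a)) (q := (z, a + 1)) ⟨h3, ne_self a⟩
    rw [hp'] at g1
    rw [hq'] at g3
    exact (petersen_walk_three x x).1 ⟨_, g1.1, _, g2.1, g3.1⟩ rfl

/-- The vertices of the Petersen graph correspond to the pairs. -/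
noncomputable def pairEquiv : ZMod 5 ⊕ ZMod 5 ≃ {s : Finset (Fin 5) // s.card = 2} :=
  Equiv.ofBijective (fun x => ⟨pairLabel x, pairLabel_card x⟩)
    ⟨fun _ _ h => pairLabel_injective (congrArg Subtype.val h), fun ⟨s, hs⟩ => by
      obtain ⟨x, hx⟩ := exists_pairLabel s hs
      exact ⟨x, Subtype.ext hx⟩⟩

/-- The map on the vertices of the Petersen graph induced by a permutation of five points. -/
noncomputable def pairMap (σ : Equiv.Perm (Fin 5)) (x : ZMod 5 ⊕ ZMod 5) : ZMod 5 ⊕ ZMod 5 :=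
  pairEquiv.symm ⟨(pairLabel x).map σ.toEmbedding, by rw [Finset.card_map, pairLabel_card]⟩

lemma pairLabel_pairMap (σ : Equiv.Perm (Fin 5)) (x : ZMod 5 ⊕ ZMod 5) :
    pairLabel (pairMap σ x) = (pairLabel x).map σ.toEmbedding :=
  congrArg Subtype.val (pairEquiv.apply_symm_apply _)

lemma pairMap_mul (σ τ : Equiv.Perm (Fin 5)) (x : ZMod 5 ⊕ ZMod 5) :
    pairMap (σ * τ) x = pairMap σ (pairMap τ x) := by
  apply pairLabel_injective
  simp only [pairLabel_pairMap, Finset.map_map]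
  rfl

lemma pairMap_one (x : ZMod 5 ⊕ ZMod 5) : pairMap 1 x = x := by
  apply pairLabel_injective
  rw [pairLabel_pairMap]
  exact Finset.map_refl

/-- The action of the symmetric group of degree five on the Petersen graph. -/
noncomputable def petersenHom : Equiv.Perm (Fin 5) →* AutGroup (GP 5 2) where
  toFun σ :=
    { toFun := pairMap σ
      invFun := pairMap σ⁻¹
      left_inv x := by rw [← pairMap_mul, inv_mul_cancel, pairMap_one]
      right_inv x := by rw [← pairMap_mul, mul_inv_cancel, pairMap_one]
      map_rel_iff' := by
        intro x y
        simp only [Equiv.coe_fn_mk, pairLabel_adj, pairLabel_pairMap, Finset.disjoint_map] }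
  map_one' := by
    ext x
    exact pairMap_one x
  map_mul' σ τ := by
    ext x
    exact pairMap_mul σ τ x

lemma petersenHom_injective : Function.Injective petersenHom := by
  refine (injective_iff_map_eq_one _).2 fun σ hσ => ?_
  have h : ∀ x, (pairLabel x).map σ.toEmbedding = pairLabel x := fun x => by
    rw [← pairLabel_pairMap]
    exact congrArg pairLabel (DFunLike.congr_fun hσ x)
  ext1 a
  -- A point is the intersection of two pairs, so a permutation fixing all pairs fixes all points.
  obtain ⟨x, y, hxy⟩ := exists_inter_pairLabel a
  have : ({a} : Finset (Fin 5)).map σ.toEmbedding = {a} := by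
    rw [← hxy, Finset.map_inter, h, h]
  simpa using this

lemma petersen_eq_one {χ : AutGroup (GP 5 2)} (h0 : χ (Sum.inl 0) = Sum.inl 0)
    (h1 : χ (Sum.inl 1) = Sum.inl 1) (h2 : χ (Sum.inl 2) = Sum.inl 2)
    (h3 : χ (Sum.inl 3) = Sum.inl 3) : χ = 1 := by
  have adj : ∀ {x y}, (GP 5 2).Adj x y → (GP 5 2).Adj (χ x) (χ y) := fun h => χ.map_rel_iff.2 h
  have h4 : χ (Sum.inl 4) = Sum.inl 4 := by
    refine petersen_common_neighbor _ ?_ ?_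
    · rw [← h3]
      exact adj (by decide +kernel)
    · rw [← h0]
      exact adj (by decide +kernel)
  have hl : ∀ i, χ (Sum.inl i) = Sum.inl i := by
    intro i
    fin_cases i
    exacts [h0, h1, h2, h3, h4]
  ext x
  rcases x with i | i
  · exact hl i
  · have ha := adj (adj_swap (Sum.inl i))
    rcases hx : χ (Sum.inr i) with j | j
    · rw [← hl j] at hx
      exact absurd (χ.injective hx) (by simp)
    · simp only [Sum.swap_inl, hx, hl, adj_inl_inr] at ha
      rw [ha]
      rfl

/-- An automorphism is determined by the image of the 3-arc `u_0 u_1 u_2 u_3`, so there are at most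
`120 = 5!` of them, and the injection from `S₅` is onto. -/
lemma petersenHom_bijective : Function.Bijective petersenHom := by
  let f : AutGroup (GP 5 2) → petersenArcs := fun φ =>
    ⟨(φ (Sum.inl 0), φ (Sum.inl 1), φ (Sum.inl 2), φ (Sum.inl 3)), by
      have h := outer_mem_petersenArcs
      simp only [petersenArcs, Finset.mem_filter, Finset.mem_univ, true_and] at h ⊢
      obtain ⟨h1, h2, h3, h4, h5⟩ := h
      exact ⟨φ.map_rel_iff.2 h1, φ.map_rel_iff.2 h2, φ.injective.ne h3, φ.map_rel_iff.2 h4,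
        φ.injective.ne h5⟩⟩
  have hf : Function.Injective f := by
    intro φ ψ h
    simp only [f, Subtype.mk.injEq, Prod.mk.injEq] at h
    obtain ⟨h0, h1, h2, h3⟩ := h
    have e : ∀ {x}, φ x = ψ x → (ψ⁻¹ * φ) x = x := fun {x} h => by
      rw [RelIso.mul_apply, h, ← RelIso.mul_apply, inv_mul_cancel, RelIso.one_apply]
    exact (inv_mul_eq_one.1 (petersen_eq_one (e h0) (e h1) (e h2) (e h3))).symm
  have : Finite (AutGroup (GP 5 2)) := Finite.of_injective f hf
  refine petersenHom_injective.bijective_of_nat_card_le ?_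
  refine (Nat.card_le_card_of_injective f hf).trans ?_
  rw [Nat.card_eq_fintype_card, Nat.card_eq_fintype_card, Fintype.card_coe, card_petersenArcs,
    Fintype.card_perm, Fintype.card_fin]
  rfl

end Petersen

/-! ### Assembly. -/

section Main

variable {n k l : ℕ}

/-- Treats both parities of `k` at once: `l = k` and `l = n - k` are the two instances of `hlk`. -/
theorem cover_results (hn : Odd n) (hk : 1 ≤ k) (hkn : 2 * k < n) (hlo : Odd l) (hln : l < n)
    (hlk : (l : ZMod n) = k ∨ (l : ZMod n) = -k) :
    Nonempty (DGP n k ≃g GP (2 * n) l) ∧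
    (¬ (n = 5 ∧ l = 3) → IsStable (GP n k) ∧
      (¬ (k : ℤ) ^ 2 ≡ 1 [ZMOD n] ∧ ¬ (k : ℤ) ^ 2 ≡ -1 [ZMOD n] → AEqF n k (2 * n) l) ∧
      ((k : ℤ) ^ 2 ≡ 1 [ZMOD n] → AEqJ n k (2 * n) l) ∧
      ((k : ℤ) ^ 2 ≡ -1 [ZMOD n] → AEqH n k (2 * n) l)) := by
  have h3 : 3 ≤ n := by omega
  have : NeZero n := ⟨by omega⟩
  have : NeZero (2 * n) := ⟨by omega⟩
  have h2 : (2 : ZMod n) ≠ 0 := by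
    intro h
    have h : ((2 : ℕ) : ZMod n) = 0 := by exact_mod_cast h
    exact absurd (Nat.le_of_dvd two_pos ((ZMod.natCast_eq_zero_iff _ _).1 h)) (by omega)
  have hk2 : (2 * k : ZMod n) ≠ 0 := by
    intro h
    have h : ((2 * k : ℕ) : ZMod n) = 0 := by exact_mod_cast h
    exact absurd (Nat.le_of_dvd (by omega) ((ZMod.natCast_eq_zero_iff _ _).1 h)) (by omega)
  have h2' := two_ne_zero_zmod h3
  have hl' := two_mul_ne_zero_zmod hlo.pos hln
  have e := coverIso hn hlo h2 hk2 h2' hl' hlk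
  refine ⟨⟨e⟩, fun hne => ?_⟩
  have hφ := map_swap hn hlo hln hne
  have s1 : (k : ℤ) ^ 2 ≡ 1 [ZMOD n] ↔ (l : ZMod (2 * n)) ^ 2 = 1 := by
    simpa using sq_eq_iff hn hlo hlk 1 (by decide)
  have s2 : (k : ℤ) ^ 2 ≡ -1 [ZMOD n] ↔ (l : ZMod (2 * n)) ^ 2 = -1 := by
    simpa using sq_eq_iff hn hlo hlk (-1) (by decide)
  rw [s1, s2]
  exact ⟨isStable_GP hn hlo h2 hk2 h2' hl' hlk hφ,
    fun h => autIsPresented_relsF h2' hl' hφ e (not_or.2 h),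
    fun h => autIsPresented_relsJ h2' hl' hφ e h, fun h => autIsPresented_relsH h2' hl' hφ e h⟩

end Main

end GenPetersen

theorem proposition3p1 (n k : ℕ) (hn : Odd n) (hk : 1 ≤ k) (hkn : 2 * k < n) :
    (Odd k → Nonempty (DGP n k ≃g GP (2 * n) k)) ∧
    (Even k → Nonempty (DGP n k ≃g GP (2 * n) (n - k))) ∧
    IsStable (GP n k) ∧
    (Odd k →
      (¬ (k : ℤ) ^ 2 ≡ 1 [ZMOD n] ∧ ¬ (k : ℤ) ^ 2 ≡ -1 [ZMOD n] → AEqF n k (2 * n) k) ∧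
      ((k : ℤ) ^ 2 ≡ 1 [ZMOD n] → AEqJ n k (2 * n) k) ∧
      ((k : ℤ) ^ 2 ≡ -1 [ZMOD n] → AEqH n k (2 * n) k)) ∧
    (Even k → ¬ (n = 5 ∧ k = 2) →
      (¬ (k : ℤ) ^ 2 ≡ 1 [ZMOD n] ∧ ¬ (k : ℤ) ^ 2 ≡ -1 [ZMOD n] → AEqF n k (2 * n) (n - k)) ∧
      ((k : ℤ) ^ 2 ≡ 1 [ZMOD n] → AEqJ n k (2 * n) (n - k)) ∧
      ((k : ℤ) ^ 2 ≡ -1 [ZMOD n] → AEqH n k (2 * n) (n - k))) ∧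
    Nonempty (A 5 2 ≃* Equiv.Perm (Fin 5) × Multiplicative (ZMod 2)) := by
  have odd : Odd k → _ := fun ho =>
    cover_results (l := k) hn hk hkn ho (by omega) (Or.inl rfl)
  have even : Even k → _ := fun he =>
    cover_results (l := n - k) hn hk hkn (Nat.Odd.sub_even (by omega) hn he) (by omega)
      (Or.inr (by rw [Nat.cast_sub (by omega), ZMod.natCast_self, zero_sub]))
  refine ⟨fun ho => (odd ho).1, fun he => (even he).1, ?_, fun ho => ?_, fun he hne => ?_, ?_⟩
  · rcases Nat.even_or_odd k with he | ho
    · by_cases h : n = 5 ∧ k = 2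
      · obtain ⟨rfl, rfl⟩ := h
        exact isStable_petersen
      · exact ((even he).2 (by omega)).1
    · exact ((odd ho).2 (by omega)).1
  · exact ((odd ho).2 (by omega)).2
  · exact ((even he).2 (by omega)).2
  · exact ⟨(MulEquiv.ofBijective _ isStable_petersen).symm.trans
      (MulEquiv.prodCongr (MulEquiv.ofBijective _ petersenHom_bijective).symm (MulEquiv.refl _))⟩
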